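/- Let $(\mathcal M,\{\,,\,,\,\})$ be a finite-dimensional Hermitian positive Jordan triple system: $\{u,v,w\}$ is $\mathbb C$-linear and symmetric in $u,w$, $\mathbb C$-antilinear in $v$, satisfies $$\{x,y,\{u,v,w\}\}-\{u,v,\{x,y,w\}\}=\{\{x,y,u\},v,w\}-\{u,\{v,x,y\},w\},$$ and, with $T(u,v)w=\{u,v,w\}$, the Hermitian form $(u\mid v)=\operatorname{tr}T(u,v)$ is positive definite. Put $Q(x)y=\tfrac12\{x,y,x\}$ and let $B(x,y)=\operatorname{id}-T(x,y)+Q(x)Q(y)$ be the Bergman operator. Let $M\subset\mathcal M$ be the associated Hermitian symmetric space of noncompact type in its circled realization as a bounded symmetric domain, i.e. the connected component of $0$ in the set of all $u$ such that $B(u,u)$ is positive definite with respect to $(\cdot\mid\cdot)$. Let $K_M(z,\bar w)$, holomorphic in $z$ and antiholomorphic in $w$, be the reproducing kernel of $M$, that is, of the Hilbert space of square integrable holomorphic functions on $M$ for Lebesgue measure on $M$ normalized to total mass one. Let $K_{M^*}$ be the reproducing kernel of the compact dual $M^*$ in the affine chart $M^*\setminus\operatorname{Cut}_0(M^*)\cong\mathcal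 M$, i.e. the function $K_{M^*}(z,\bar w)$ on $\mathcal M\times\mathcal M$, holomorphic in $z$ and antiholomorphic in $w$, with $$K_{M^*}(z,\bar w)=\frac1{K_M(z,-\bar w)}\qquad (z,w\in M),$$ so that $K_{M^*}(z,\bar z)=1/K_M(z,-\bar z)$. Let $\Psi_M:M\to M^*\setminus\operatorname{Cut}_0(M^*)\cong\mathcal M$, $\Psi_M(z)=B(z,z)^{-1/4}z$, be the symplectic duality map. Then $K_M$ and $K_{M^*}$ exist, and $$K_{M^*}\circ\Psi_M=K_M,$$ i.e. $K_{M^*}(\Psi_M(z),\overline{\Psi_M(z)})=K_M(z,\bar z)$ for all $z\in M$. -/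

import Mathlib

open scoped ComplexConjugate

/-- A Hermitian positive Jordan triple system on a finite-dimensional complex vector space `V`:
a triple product `{u, v, w}`, complex linear and symmetric in `u` and `w` and antilinear in `v`,
which satisfies the Jordan identity and whose trace form `tr T(u, v)`, where
`T(u, v) w = {u, v, w}`, is positive definite. -/
structure HPJTS (V : Type*) [NormedAddCommGroup V] [NormedSpace ℂ V]
    [FiniteDimensional ℂ V] where
  triple : V →ₗ[ℂ] V →ₗ⋆[ℂ] V →ₗ[ℂ] V
  triple_symm : ∀ u v w, triple u v w = triple w v u
  jordan : ∀ x y u v w,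
    triple x y (triple u v w) - triple u v (triple x y w)
      = triple (triple x y u) v w - triple u (triple v x y) w
  trace_pos : ∀ u, u ≠ 0 →
    0 < (LinearMap.trace ℂ V (triple u u)).re ∧ (LinearMap.trace ℂ V (triple u u)).im = 0

namespace HPJTS

variable {V : Type*} [NormedAddCommGroup V] [NormedSpace ℂ V] [FiniteDimensional ℂ V]

/-- The operator `T(x, y) z = {x, y, z}`. -/
def T (J : HPJTS V) (x y : V) : V →ₗ[ℂ] V := J.triple x y

/-- The antilinear operator `Q(x) y = (1/2) {x, y, x}`. -/
noncomputable def Q (J : HPJTS V) (x : V) : V →ₗ⋆[ℂ] V where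
  toFun y := (1 / 2 : ℂ) • J.triple x y x
  map_add' y y' := by simp
  map_smul' c y := by
    simp only [map_smulₛₗ, LinearMap.smul_apply]
    rw [smul_comm]

/-- The Bergman operator `B(x, y) = id - T(x, y) + Q(x) Q(y)`. -/
noncomputable def B (J : HPJTS V) (x y : V) : V →ₗ[ℂ] V :=
  LinearMap.id - J.T x y + (J.Q x).comp (J.Q y)

/-- The trace form `(u | v) = tr T(u, v)`, linear in `u` and antilinear in `v`. -/
noncomputable def form (J : HPJTS V) (u v : V) : ℂ := LinearMap.trace ℂ V (J.T u v)

/-- Positive definiteness of a complex linear operator with respect to the trace form: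
`(A x | x)` is a positive real number for every nonzero `x`. Over the complex numbers this forces
`A` to be self-adjoint. -/
def IsPosDef (J : HPJTS V) (A : V →ₗ[ℂ] V) : Prop :=
  ∀ x, x ≠ 0 → 0 < (J.form (A x) x).re ∧ (J.form (A x) x).im = 0

/-- The bounded symmetric domain of `J` in its circled realization: the connected component of the
origin in the set of all `u` for which `B(u, u)` is positive definite. -/
def domain (J : HPJTS V) : Set V := connectedComponentIn {u | J.IsPosDef (J.B u u)} 0

/-- `S` is the positive operator `A ^ (-1/4)`. -/
def IsInvFourthRoot (J : HPJTS V) (A S : V →ₗ[ℂ] V) : Prop :=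
  J.IsPosDef S ∧ S ∘ₗ S ∘ₗ S ∘ₗ S ∘ₗ A = LinearMap.id

/-- The trace form as an inner product. -/
@[reducible] noncomputable def core (J : HPJTS V) : InnerProductSpace.Core ℂ V := by
  have hadd : ∀ x y z, J.form (x + y) z = J.form x z + J.form y z := fun x y z => by
    simp [form, T]
  have hadd' : ∀ x y z, J.form x (y + z) = J.form x y + J.form x z := fun x y z => by
    simp [form, T]
  have hsm : ∀ (c : ℂ) x y, J.form (c • x) y = c * J.form x y := fun c x y => by
    simp [form, T]
  have hsm' : ∀ (c : ℂ) x y, J.form x (c • y) = conj c * J.form x y := fun c x y => by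
    simp [form, T]
  have hre : ∀ x, 0 ≤ (J.form x x).re ∧ (J.form x x).im = 0 := fun x => by
    by_cases hx : x = 0
    · subst hx
      simp [form, T]
    · exact ⟨(J.trace_pos x hx).1.le, (J.trace_pos x hx).2⟩
  exact
    { inner := fun x y => J.form y x
      conj_inner_symm := fun x y => by
        have h1 := (hre (x + y)).2
        have h2 := (hre (x + Complex.I • y)).2
        have hx := (hre x).2
        have hy := (hre y).2
        simp only [hadd, hadd', hsm, hsm', Complex.add_im, Complex.mul_im, Complex.mul_re,
          Complex.conj_I, Complex.I_re, Complex.I_im, Complex.neg_re, Complex.neg_im] at h1 h2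
        apply Complex.ext <;> simp <;> linarith
      re_inner_nonneg := fun x => (hre x).1
      add_left := fun x y z => hadd' z x y
      smul_left := fun x y r => hsm' r y x
      definite := fun x hx => by
        by_contra h
        have := (J.trace_pos x h).1
        have hx' : LinearMap.trace ℂ V (J.triple x x) = 0 := hx
        rw [hx'] at this
        simp at this }

/-- In a finite-dimensional complex inner product space, a positive definite operator has exactly
one positive definite inverse fourth root. -/
theorem existsUnique_invFourthRoot_aux {E : Type*} [AddCommGroup E] [Module ℂ E]
    [FiniteDimensional ℂ E] (c : InnerProductSpace.Core ℂ E) (A : E →ₗ[ℂ] E)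
    (hA : ∀ x, x ≠ 0 → 0 < (c.inner x (A x)).re ∧ (c.inner x (A x)).im = 0) :
    ∃! S : E →ₗ[ℂ] E, (∀ x, x ≠ 0 → 0 < (c.inner x (S x)).re ∧ (c.inner x (S x)).im = 0) ∧
      S ∘ₗ S ∘ₗ S ∘ₗ S ∘ₗ A = LinearMap.id := by
  let _ : NormedAddCommGroup E := c.toNormedAddCommGroup
  let _ : InnerProductSpace ℂ E := InnerProductSpace.ofCore c.toCore
  have hin : ∀ x y : E, c.inner x y = inner ℂ x y := fun _ _ => rfl
  simp only [hin] at hA ⊢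
  have hsymm : ∀ C : E →ₗ[ℂ] E,
      (∀ x, x ≠ 0 → 0 < (inner ℂ x (C x)).re ∧ (inner ℂ x (C x)).im = 0) → C.IsSymmetric := by
    intro C hC
    rw [LinearMap.isSymmetric_iff_inner_map_self_real]
    intro x
    by_cases hx : x = 0
    · simp [hx]
    · rw [inner_conj_symm, ← inner_conj_symm (C x) x]
      exact (Complex.conj_eq_iff_im.2 (hC x hx).2).symm
  have hpos : ∀ C : E →ₗ[ℂ] E,
      (∀ x, x ≠ 0 → 0 < (inner ℂ x (C x)).re ∧ (inner ℂ x (C x)).im = 0) →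
      ∀ (r : ℝ) (x : E), x ≠ 0 → C x = (r : ℂ) • x → 0 < r := by
    intro C hC r x hx h
    have h1 := (hC x hx).1
    rw [h, inner_smul_right, inner_self_eq_norm_sq_to_K] at h1
    have h2 : ((r : ℂ) * ((‖x‖ : ℂ) ^ 2)).re = r * ‖x‖ ^ 2 := by
      rw [← Complex.ofReal_pow, ← Complex.ofReal_mul, Complex.ofReal_re]
    have h3 : 0 < r * ‖x‖ ^ 2 := h2 ▸ h1
    exact pos_of_mul_pos_left h3 (by positivity)
  have hsA := hsymm A hA
  refine existsUnique_of_exists_of_unique ?_ ?_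
  · set b := hsA.eigenvectorBasis rfl with hb
    set e := hsA.eigenvalues rfl with he
    have hAb : ∀ i, A (b i) = (e i : ℂ) • b i := fun i => hsA.apply_eigenvectorBasis rfl i
    have hb0 : ∀ i, b i ≠ 0 := fun i => b.orthonormal.ne_zero i
    have he0 : ∀ i, 0 < e i := fun i => hpos A hA _ _ (hb0 i) (hAb i)
    let r : Fin (Module.finrank ℂ E) → ℝ := fun i => (e i) ^ (-(1 / 4) : ℝ)
    have hr0 : ∀ i, 0 < r i := fun i => Real.rpow_pos_of_pos (he0 i) _
    have hr4 : ∀ i, r i ^ 4 * e i = 1 := by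
      intro i
      have h1 : r i ^ 4 = (e i)⁻¹ := by
        rw [← Real.rpow_natCast, ← Real.rpow_mul (he0 i).le, ← Real.rpow_neg_one]
        norm_num
      rw [h1, inv_mul_cancel₀ (he0 i).ne']
    let S : E →ₗ[ℂ] E := b.toBasis.constr ℂ (fun i => (r i : ℂ) • b i)
    have hSb : ∀ i, S (b i) = (r i : ℂ) • b i := fun i => by
      have := b.toBasis.constr_basis ℂ (fun i => (r i : ℂ) • b i) i
      rwa [b.coe_toBasis] at this
    refine ⟨S, ?_, ?_⟩
    · intro x hx
      have hSx : S x = ∑ i, inner ℂ (b i) x • ((r i : ℂ) • b i) := by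
        conv_lhs => rw [← b.sum_repr' x]
        simp [map_sum, hSb]
      have hx2 : inner ℂ x (S x) = ((∑ i, r i * ‖inner ℂ (b i) x‖ ^ 2 : ℝ) : ℂ) := by
        rw [hSx, inner_sum]
        push_cast
        refine Finset.sum_congr rfl fun i _ => ?_
        rw [inner_smul_right, inner_smul_right, ← inner_conj_symm x (b i), ← Complex.mul_conj']
        ring
      rw [hx2]
      refine ⟨?_, Complex.ofReal_im _⟩
      rw [Complex.ofReal_re]
      have hne : ∃ i, inner ℂ (b i) x ≠ 0 := by
        by_contra! h
        exact hx (by rw [← b.sum_repr' x]; simp [h])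
      obtain ⟨i, hi⟩ := hne
      exact Finset.sum_pos' (fun i _ => mul_nonneg (hr0 i).le (by positivity))
        ⟨i, Finset.mem_univ _, mul_pos (hr0 i) (by positivity)⟩
    · refine b.toBasis.ext fun i => ?_
      rw [b.coe_toBasis]
      simp only [LinearMap.comp_apply, hAb, hSb, map_smul, smul_smul, LinearMap.id_apply]
      have h : (r i : ℂ) ^ 4 * (e i : ℂ) = 1 := by exact_mod_cast hr4 i
      rw [show (e i : ℂ) * (r i : ℂ) * r i * r i * r i = (r i : ℂ) ^ 4 * (e i : ℂ) by ring, h,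
        one_smul]
  · rintro S R ⟨hS, hSA⟩ ⟨hR, hRA⟩
    have hR' := hsymm R hR
    have hpow : R ^ 4 = S ^ 4 := by
      have h1 : S ^ 4 * A = 1 := by
        exact hSA
      have h2 : R ^ 4 * A = 1 := by
        exact hRA
      have h3 : A * S ^ 4 = 1 := mul_eq_one_comm.1 h1
      calc R ^ 4 = R ^ 4 * (A * S ^ 4) := by rw [h3, mul_one]
        _ = S ^ 4 := by rw [← mul_assoc, h2, one_mul]
    set b := (hsymm S hS).eigenvectorBasis rfl with hb
    have hb0 : ∀ i, b i ≠ 0 := fun i => b.orthonormal.ne_zero i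
    refine b.toBasis.ext fun i => ?_
    rw [b.coe_toBasis]
    obtain ⟨s, hSs⟩ : ∃ s : ℝ, S (b i) = (s : ℂ) • b i :=
      ⟨_, (hsymm S hS).apply_eigenvectorBasis rfl i⟩
    have hs := hpos S hS s _ (hb0 i) hSs
    have h4 : R (R (R (R (b i)))) = ((s : ℂ) ^ 4) • b i := by
      have h := LinearMap.congr_fun hpow (b i)
      have h' : (S ^ 4) (b i) = S (S (S (S (b i)))) := rfl
      have h'' : (R ^ 4) (b i) = R (R (R (R (b i)))) := rfl
      rw [h', h''] at h
      rw [h]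
      simp only [hSs, map_smul, smul_smul]
      ring_nf
    set y := R (b i) - (s : ℂ) • b i with hy
    set u := R (R y) + ((s : ℂ) ^ 2) • y with hu
    have hu0 : u = 0 := by
      by_contra hne
      have h : R u = ((-s : ℝ) : ℂ) • u := by
        have h0 : R u + (s : ℂ) • u = 0 := by
          simp only [hu, hy, map_sub, map_add, map_smul, h4]
          module
        rw [eq_neg_of_add_eq_zero_left h0]
        push_cast
        rw [neg_smul]
      have := hpos R hR (-s) u hne h
      linarith
    have hy0 : y = 0 := by
      have h1 : inner ℂ y u = 0 := by rw [hu0, inner_zero_right]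
      rw [hu, inner_add_right, inner_smul_right, ← hR' y (R y), inner_self_eq_norm_sq_to_K,
        inner_self_eq_norm_sq_to_K] at h1
      have h5 : ‖R y‖ ^ 2 + s ^ 2 * ‖y‖ ^ 2 = 0 := by
        apply Complex.ofReal_injective
        push_cast
        exact h1
      have h2 : s ^ 2 * ‖y‖ ^ 2 = 0 := by
        have := sq_nonneg ‖R y‖
        have : 0 ≤ s ^ 2 * ‖y‖ ^ 2 := by positivity
        linarith
      have h3 : ‖y‖ ^ 2 = 0 := by
        rcases mul_eq_zero.1 h2 with h | h
        · exact absurd h (by positivity)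
        · exact h
      exact norm_eq_zero.1 (pow_eq_zero_iff (by norm_num) |>.1 h3)
    rw [hSs, eq_comm]
    exact sub_eq_zero.1 hy0

/-- A positive definite operator has exactly one positive definite inverse fourth root. -/
theorem existsUnique_invFourthRoot (J : HPJTS V) {A : V →ₗ[ℂ] V} (hA : J.IsPosDef A) :
    ∃! S, J.IsInvFourthRoot A S :=
  existsUnique_invFourthRoot_aux J.core A hA

open Classical in
/-- The operator `A ^ (-1/4)` (used only for positive definite `A`). -/
noncomputable def invFourthRoot (J : HPJTS V) (A : V →ₗ[ℂ] V) : V →ₗ[ℂ] V :=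
  if hA : J.IsPosDef A then (J.existsUnique_invFourthRoot hA).choose else 0

/-- The symplectic duality map `Ψ(z) = B(z, z) ^ (-1/4) z`, defined on the domain of `J`. Its
target, the complement of the cut locus of the origin in the compact dual, is identified with
`V`. -/
noncomputable def symplecticDuality (J : HPJTS V) (z : V) : V := J.invFourthRoot (J.B z z) z

/-- `K` is the reproducing (Bergman) kernel of the domain `M` of `J`: the reproducing kernel of the
Hilbert space of square integrable holomorphic functions on `M`, for Lebesgue measure on `M`
normalized to total mass one. The values of `K` outside `M × M` are irrelevant. -/
structure IsReproducingKernel (J : HPJTS V) [MeasurableSpace V] (μ : MeasureTheory.Measure V)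
    (K : V → V → ℂ) : Prop where
  holo : ∀ w ∈ J.domain, DifferentiableOn ℂ (fun z => K z w) J.domain
  memLp : ∀ w ∈ J.domain,
    MeasureTheory.MemLp (fun z => K z w) 2 (ProbabilityTheory.cond μ J.domain)
  reproducing : ∀ f : V → ℂ, DifferentiableOn ℂ f J.domain →
    MeasureTheory.MemLp f 2 (ProbabilityTheory.cond μ J.domain) →
    ∀ w ∈ J.domain, f w = ∫ z, f z * conj (K z w) ∂(ProbabilityTheory.cond μ J.domain)

/-- `L` is the reproducing kernel of the compact dual, in the affine chart `V`: the function on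
`V × V`, holomorphic in the first variable and antiholomorphic in the second, which on `M × M` is
given by `L z w = 1 / K z (-w)` with nonvanishing denominator. It is determined by its values on
`M × M`. -/
structure IsDualKernel (J : HPJTS V) (K L : V → V → ℂ) : Prop where
  holo : ∀ w, Differentiable ℂ (fun z => L z w)
  antiholo : ∀ z, Differentiable ℂ (fun w => conj (L z w))
  ne_zero : ∀ z ∈ J.domain, ∀ w ∈ J.domain, K z (-w) ≠ 0
  eq_inv : ∀ z ∈ J.domain, ∀ w ∈ J.domain, L z w = 1 / K z (-w)

end HPJTS

/-! ### Simultaneous diagonalization for a positive definite sesquilinear form -/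

section Core

variable {E : Type*} [AddCommGroup E] [Module ℂ E] [FiniteDimensional ℂ E]

/-! Everything reduces to two facts: the Bergman kernel of the domain M is `1 / det B(z, w)`, and
`B(Ψ z, -Ψ z)` is the inverse of `B(z, z)`. Since `det B(z, -w)` is entire in `z` and in `conj w`,
it is then the dual kernel, and its value at `(Ψ z, Ψ z)` is `1 / det B(z, z)`.

The second fact is scalar once spectral theory is available. By `exists_spectral`, `z = ∑ λ_i e_i`
with orthogonal tripotents `e_i`. The operators `T(e_i, e_i)` commute and are self-adjoint for the
trace form, and their joint eigenspaces `V_ij` (indices possibly 0, with `λ_0 = 0`) are those of the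
Peirce decomposition. There `B(z, z)` is multiplication by `(1 - λ_i²)(1 - λ_j²)`, so `Ψ z = ∑ λ_i
(1 - λ_i²)^(-1/2) e_i`. The identity `1 + λ²/(1 - λ²) = 1/(1 - λ²)` then gives
`bergman_symplecticDuality`. The same eigenvalues identify M with the spectral ball `λ_i² < 1`
(`domain_eq_specBall`), which is open, bounded and balanced.

For the kernel, the vector fields `v - Q(z) v` have holomorphic flows `φ` preserving M with `B(φ z,
φ w) = φ'(z) B(z, w) φ'(w)*` (`IsFlowLine.bergman_eq`). The curves `∑ tanh(t m_i) e_i` are flow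
lines through 0, hence these automorphisms act transitively (`exists_isAut_apply_zero`). At `w = 0`
the kernel `1 / det B(z, 0)` is 1, and the reproducing property is the mean value property of a
circled domain; a change of variables carries it to every `w`. Transitivity also shows that `det B`
has no zeros on M × M. Finally both kernels are unique, the dual one by the identity theorem, so the
formulas hold for any given `K` and `L`. -/

theorem core_iSup_eigenspace_eq_top (c : InnerProductSpace.Core ℂ E) {L : E →ₗ[ℂ] E}
    (hL : ∀ x y, c.inner (L x) y = c.inner x (L y)) :
    ⨆ μ, Module.End.eigenspace L μ = ⊤ := by
  let _ : NormedAddCommGroup E := c.toNormedAddCommGroup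
  let _ : InnerProductSpace ℂ E := InnerProductSpace.ofCore c.toCore
  have hs : L.IsSymmetric := hL
  exact Submodule.orthogonal_eq_bot_iff.1 hs.orthogonalComplement_iSup_eigenspaces_eq_bot

/-- The norm of `V` in the main theorem is unrelated to the trace form. Spectral theory is therefore
stated for a bare space with an inner product core, whose norm is installed only inside the proofs.
-/
theorem core_iSup_iInf_eigenspace_eq_top (c : InnerProductSpace.Core ℂ E) {ι : Type*}
    {L : ι → E →ₗ[ℂ] E} (hL : ∀ i x y, c.inner (L i x) y = c.inner x (L i y))
    (hc : ∀ i j, Commute (L i) (L j)) :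
    ⨆ χ : ι → ℂ, ⨅ i, Module.End.eigenspace (L i) (χ i) = ⊤ := by
  let _ : NormedAddCommGroup E := c.toNormedAddCommGroup
  let _ : InnerProductSpace ℂ E := InnerProductSpace.ofCore c.toCore
  have hs : ∀ i, (L i).IsSymmetric := hL
  exact LinearMap.IsSymmetric.iSup_iInf_eq_top_of_commute hs fun i j _ => hc i j

theorem core_linearMap_ext (c : InnerProductSpace.Core ℂ E) {ι : Type*}
    {L : ι → E →ₗ[ℂ] E} (hL : ∀ i x y, c.inner (L i x) y = c.inner x (L i y))
    (hc : ∀ i j, Commute (L i) (L j)) {A A' : E →ₗ[ℂ] E}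
    (h : ∀ (χ : ι → ℂ) (x : E), x ≠ 0 → (∀ i, L i x = χ i • x) → A x = A' x) : A = A' := by
  have htop : (⊤ : Submodule ℂ E) ≤ LinearMap.eqLocus A A' := by
    rw [← core_iSup_iInf_eigenspace_eq_top c hL hc]
    refine iSup_le fun χ x hx => ?_
    rw [Submodule.mem_iInf] at hx
    by_cases hx0 : x = 0
    · simp [hx0]
    · exact h χ x hx0 fun i => Module.End.mem_eigenspace_iff.1 (hx i)
  ext x
  exact htop (Submodule.mem_top (x := x))

/-- Distinct joint eigenspaces are orthogonal, so `(A x | x)` is the sum of the `r χ * ‖x_χ‖²` over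
the components of `x`. -/
theorem core_posDef_of_joint (c : InnerProductSpace.Core ℂ E) {ι : Type*}
    {L : ι → E →ₗ[ℂ] E} (hL : ∀ i x y, c.inner (L i x) y = c.inner x (L i y))
    (hc : ∀ i j, Commute (L i) (L j)) {A : E →ₗ[ℂ] E}
    (h : ∀ χ : ι → ℂ, ∃ r : ℝ, 0 < r ∧ ∀ x : E, (∀ i, L i x = χ i • x) → A x = (r : ℂ) • x)
    (x : E) (hx : x ≠ 0) : 0 < (c.inner x (A x)).re ∧ (c.inner x (A x)).im = 0 := by
  let _ : NormedAddCommGroup E := c.toNormedAddCommGroup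
  let _ : InnerProductSpace ℂ E := InnerProductSpace.ofCore c.toCore
  have hs : ∀ i, (L i).IsSymmetric := hL
  choose r hr hA using h
  have hmem : x ∈ ⨆ χ : ι → ℂ, ⨅ i, Module.End.eigenspace (L i) (χ i) := by
    rw [core_iSup_iInf_eigenspace_eq_top c hL hc]; trivial
  obtain ⟨f, hf, hsum⟩ := (Submodule.mem_iSup_iff_exists_finsupp _ _).1 hmem
  have hfe : ∀ χ i, L i (f χ) = χ i • f χ := fun χ i =>
    Module.End.mem_eigenspace_iff.1 ((Submodule.mem_iInf _).1 (hf χ) i)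
  have horth : ∀ χ χ', χ ≠ χ' → inner ℂ (f χ) (f χ') = 0 := fun χ χ' hne =>
    (LinearMap.IsSymmetric.orthogonalFamily_iInf_eigenspaces hs).pairwise hne.symm (hf χ') _ (hf χ)
  have hAx : A x = ∑ χ ∈ f.support, (r χ : ℂ) • f χ := by
    rw [← hsum, Finsupp.sum, map_sum]
    exact Finset.sum_congr rfl fun χ _ => hA χ _ (hfe χ)
  have key : (inner ℂ x (A x) : ℂ) = ((∑ χ ∈ f.support, r χ * ‖f χ‖ ^ 2 : ℝ) : ℂ) := by
    rw [hAx, inner_sum]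
    push_cast
    refine Finset.sum_congr rfl fun χ hχ => ?_
    rw [← hsum, Finsupp.sum, sum_inner, Finset.sum_eq_single χ]
    · rw [inner_smul_right, inner_self_eq_norm_sq_to_K]
      rfl
    · intro χ' _ hne
      rw [inner_smul_right, horth _ _ hne, mul_zero]
    · exact fun h => absurd hχ h
  have hin : c.inner x (A x) = inner ℂ x (A x) := rfl
  rw [hin, key]
  refine ⟨?_, Complex.ofReal_im _⟩
  rw [Complex.ofReal_re]
  refine Finset.sum_pos (fun χ hχ => ?_) ?_
  · have := Finsupp.mem_support_iff.1 hχ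
    have := hr χ
    positivity
  · rw [Finset.nonempty_iff_ne_empty]
    intro he
    apply hx
    rw [← hsum, Finsupp.sum, he, Finset.sum_empty]

theorem core_trace_nonpos (c : InnerProductSpace.Core ℂ E) {L : E →ₗ[ℂ] E}
    (hL : ∀ x y, c.inner (L x) y = c.inner x (L y))
    (h : ∀ (r : ℝ) (x : E), x ≠ 0 → L x = (r : ℂ) • x → r ≤ 0) :
    (LinearMap.trace ℂ E L).re ≤ 0 := by
  let _ : NormedAddCommGroup E := c.toNormedAddCommGroup
  let _ : InnerProductSpace ℂ E := InnerProductSpace.ofCore c.toCore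
  have hs : L.IsSymmetric := hL
  rw [hs.trace_eq_sum_eigenvalues rfl, RCLike.ofReal_eq_complex_ofReal, Complex.ofReal_re]
  refine Finset.sum_nonpos fun i _ => h _ _ ((hs.eigenvectorBasis rfl).orthonormal.ne_zero i)
    (hs.apply_eigenvectorBasis rfl i)

theorem core_exists_adjoint (c : InnerProductSpace.Core ℂ E) (A : E →ₗ[ℂ] E) :
    ∃ A' : E →ₗ[ℂ] E, (∀ x y, c.inner (A x) y = c.inner x (A' y)) ∧
      LinearMap.det A' = conj (LinearMap.det A) := by
  let _ : NormedAddCommGroup E := c.toNormedAddCommGroup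
  let _ : InnerProductSpace ℂ E := InnerProductSpace.ofCore c.toCore
  refine ⟨A.adjoint, fun x y => (LinearMap.adjoint_inner_right A x y).symm, ?_⟩
  have b := stdOrthonormalBasis ℂ E
  rw [← LinearMap.det_toMatrix b.toBasis, LinearMap.toMatrix_adjoint, Matrix.det_conjTranspose,
    LinearMap.det_toMatrix]
  rfl

end Core

namespace HPJTS

variable {V : Type*} [NormedAddCommGroup V] [NormedSpace ℂ V] [FiniteDimensional ℂ V]
  (J : HPJTS V)

/-! ### Jordan triple identities -/

theorem T_apply (x y z : V) : J.T x y z = J.triple x y z := rfl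

theorem Q_apply (x y : V) : J.Q x y = (1 / 2 : ℂ) • J.triple x y x := rfl

theorem B_apply (x y u : V) :
    J.B x y u = u - J.triple x y u + (1 / 4 : ℂ) • J.triple x (J.triple y u y) x := by
  simp only [B, LinearMap.add_apply, LinearMap.sub_apply, LinearMap.id_apply,
    LinearMap.comp_apply, T_apply, Q_apply, map_smulₛₗ, smul_smul]
  congr 2
  norm_num [Complex.ext_iff]

/-- Let `a`, `b` be the two sides and `c = {z, {v, z, y}, z}`. The Jordan identity gives `a - b = b
- c`, and with `v`, `y` exchanged `b - a = a - c`. Eliminating `c` leaves `3 (a - b) = 0`. -/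
theorem triple_comm_outer (z v y : V) :
    J.triple z v (J.triple z y z) = J.triple z y (J.triple z v z) := by
  have h1 := J.jordan z v z y z
  have h2 := J.jordan z y z v z
  have h3 := J.triple_symm (J.triple z v z) y z
  have h4 := J.triple_symm (J.triple z y z) v z
  have h5 := congrArg (fun a => J.triple z a z) (J.triple_symm y z v)
  rw [h3] at h1
  rw [h4, ← h5] at h2
  linear_combination (norm := module) (1 / 3 : ℂ) • h1 - (1 / 3 : ℂ) • h2

theorem triple_triple_inner (z v y : V) :
    J.triple z (J.triple v z y) z = J.triple z y (J.triple z v z) := by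
  have h1 := J.jordan z v z y z
  have h0 := J.triple_comm_outer z v y
  have h3 := J.triple_symm (J.triple z v z) y z
  have h5 := congrArg (fun a => J.triple z a z) (J.triple_symm y z v)
  rw [h3, h5] at h1
  linear_combination (norm := module) h1 - h0

theorem two_triple_triple (z v w y : V) :
    (2 : ℂ) • J.triple z v (J.triple z w y) =
      J.triple (J.triple z v z) w y + J.triple z (J.triple v y w) z := by
  have h1 := J.jordan y w z v z
  rw [J.triple_symm y w z, J.triple_symm y w (J.triple z v z),
    J.triple_symm (J.triple z w y) v z] at h1
  linear_combination (norm := module) -h1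

theorem two_triple_triple_middle (z w v y : V) :
    (2 : ℂ) • J.triple z w (J.triple v w y) =
      J.triple z (J.triple w y w) v + J.triple z (J.triple w v w) y := by
  have h1 := J.jordan v w z w y
  have h2 := J.jordan y w z w v
  rw [J.triple_symm v w z, J.triple_symm (J.triple z w v) w y] at h1
  rw [J.triple_symm y w z, J.triple_symm (J.triple z w y) w v, J.triple_symm y w v] at h2
  linear_combination (norm := module) -h1 - h2

/-- The case `v = w` of `two_triple_triple` expresses `Q(x) Q(y)` through operators `T`. In this
form the eigenvalues and the derivative of `B` follow from those of `T`. -/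
theorem bergman_eq (x y : V) :
    J.B x y = 1 - J.T x y +
      (1 / 2 : ℂ) • (J.T x y * J.T x y - J.T ((1 / 2 : ℂ) • J.triple x y x) y) := by
  ext u
  have h := J.two_triple_triple x y y u
  rw [B_apply]
  simp only [LinearMap.add_apply, LinearMap.sub_apply, LinearMap.smul_apply, Module.End.mul_apply,
    Module.End.one_apply, T_apply, map_smul]
  linear_combination (norm := module) (-1 / 4 : ℂ) • h

/-! ### The trace form -/

theorem form_add_left (x y z : V) : J.form (x + y) z = J.form x z + J.form y z :=
  by simp [form, T]

theorem form_smul_left (c : ℂ) (x y : V) : J.form (c • x) y = c * J.form x y := by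
  simp [form, T]

theorem form_conj (x y : V) : conj (J.form x y) = J.form y x :=
  J.core.conj_inner_symm x y

/-- The Jordan identity writes `T({x, y, u}, v) - T(u, {v, x, y})` as a commutator, whose trace
vanishes. Thus `T(y, x)` is the adjoint of `T(x, y)`. -/
theorem form_triple (x y u v : V) :
    J.form (J.triple x y u) v = J.form u (J.triple y x v) := by
  have h : J.T x y * J.T u v - J.T u v * J.T x y =
      J.T (J.triple x y u) v - J.T u (J.triple v x y) := by
    ext w
    exact J.jordan x y u v w
  have h2 := congrArg (LinearMap.trace ℂ V) h
  rw [map_sub, map_sub, LinearMap.trace_mul_comm, sub_self] at h2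
  rw [J.triple_symm y x v]
  exact (sub_eq_zero.1 h2.symm)

theorem form_bergman (x y u v : V) : J.form (J.B x y u) v = J.form u (J.B y x v) := by
  have h : ∀ a b, J.form (J.T a b u) v = J.form u (J.T b a v) := fun a b => J.form_triple a b u v
  have hQ : ∀ a b c, J.form (J.triple a b a) c = J.form (J.triple a c a) b := by
    intro a b c
    rw [J.form_triple, ← J.triple_symm c a b, ← J.form_triple, J.triple_symm a c a]
  have hQQ : J.form (J.triple x (J.triple y u y) x) v
      = J.form u (J.triple y (J.triple x v x) y) := by
    rw [hQ, ← form_conj, hQ, form_conj]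
  have hadd' : ∀ x y z, J.form x (y + z) = J.form x y + J.form x z := fun x y z => by
    simp [form, T]
  have hsub' : ∀ x y z, J.form x (y - z) = J.form x y - J.form x z := fun x y z => by
    simp [form, T]
  have hsub : ∀ x y z, J.form (x - y) z = J.form x z - J.form y z := fun x y z => by
    simp [form, T]
  have hsm' : ∀ (c : ℂ) x y, J.form x (c • y) = conj c * J.form x y := fun c x y => by
    simp [form, T]
  rw [B_apply, B_apply, form_add_left, hsub, form_smul_left, hadd', hsub', hsm', hQQ,
    form_triple]
  congr 2
  norm_num [Complex.ext_iff]

end HPJTS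

namespace HPJTS

variable {V : Type*} [NormedAddCommGroup V] [NormedSpace ℂ V] [FiniteDimensional ℂ V]
  (J : HPJTS V)

/-! ### Odd powers and the spectral theorem -/

theorem T_add_left (x y z : V) : J.T (x + y) z = J.T x z + J.T y z := by simp [T]

theorem T_add_right (x y z : V) : J.T x (y + z) = J.T x y + J.T x z := by simp [T]

theorem T_smul_left (c : ℂ) (x y : V) : J.T (c • x) y = c • J.T x y := by simp [T]

theorem T_smul_right (c : ℂ) (x y : V) : J.T x (c • y) = conj c • J.T x y := by simp [T]

theorem T_zero_left (y : V) : J.T 0 y = 0 := by simp [T]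

theorem T_zero_right (x : V) : J.T x 0 = 0 := by simp [T]

theorem T_commutator (x y u v : V) :
    J.T x y * J.T u v - J.T u v * J.T x y = J.T (J.T x y u) v - J.T u (J.T y x v) := by
  ext w
  rw [T_apply, T_apply, J.triple_symm y x v]
  exact J.jordan x y u v w

/-- This evaluates the commutator differently from `T_commutator`; comparing the two forces the
commutators of odd powers to vanish. -/
theorem T_commutator_left (z v w : V) :
    J.T z v * J.T z w - J.T z w * J.T z v =
      (1 / 2 : ℂ) • (J.T (J.triple z v z) w - J.T (J.triple z w z) v) := by
  ext y
  have h1 := J.two_triple_triple z v w y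
  have h2 := J.two_triple_triple z w v y
  rw [J.triple_symm w y v] at h2
  simp only [LinearMap.sub_apply, LinearMap.smul_apply, Module.End.mul_apply, T_apply]
  linear_combination (norm := module) (1 / 2 : ℂ) • h1 - (1 / 2 : ℂ) • h2

/-- The operator `z ↦ ½ {z, z, ·}`. -/
noncomputable def halfT (z : V) : Module.End ℂ V := (1 / 2 : ℂ) • J.T z z

/-- The odd powers of an element; `oddPow z k` is the power of exponent `2 k + 1`. -/
noncomputable def oddPow (z : V) (k : ℕ) : V := (J.halfT z ^ k) z

theorem oddPow_zero (z : V) : J.oddPow z 0 = z := rfl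

theorem oddPow_succ (z : V) (k : ℕ) : J.oddPow z (k + 1) = J.halfT z (J.oddPow z k) := by
  rw [oddPow, pow_succ', Module.End.mul_apply, oddPow]

theorem T_self_oddPow (z : V) (k : ℕ) :
    J.T z z (J.oddPow z k) = (2 : ℂ) • J.oddPow z (k + 1) := by
  rw [oddPow_succ, halfT, LinearMap.smul_apply, smul_smul]
  norm_num

/-- Induction on the sum of the indices. Moving one factor `½ T(z, z)` from the right slot to the
left adds half the commutator `C`, because `T(z, z)` is a derivation up to sign. -/
theorem T_oddPow_aux (z : V) (n : ℕ) :
    ∀ a b, a + b = n → J.T (J.oddPow z a) (J.oddPow z b) = J.T z (J.oddPow z n) := by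
  induction n with
  | zero =>
    intro a b h
    obtain ⟨rfl, rfl⟩ : a = 0 ∧ b = 0 := by omega
    rfl
  | succ n ih =>
    set C := J.T z z * J.T z (J.oddPow z n) - J.T z (J.oddPow z n) * J.T z z with hC
    have hstep : ∀ a b, a + b = n → J.T (J.oddPow z (a + 1)) (J.oddPow z b) =
        J.T (J.oddPow z a) (J.oddPow z (b + 1)) + (1 / 2 : ℂ) • C := by
      intro a b hab
      have h := J.T_commutator z z (J.oddPow z a) (J.oddPow z b)
      rw [ih a b hab, ← hC, T_self_oddPow, T_self_oddPow, T_smul_left, T_smul_right] at h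
      rw [h]
      simp only [map_ofNat]
      module
    have hall : ∀ a b, a + b = n + 1 → J.T (J.oddPow z a) (J.oddPow z b) =
        J.T z (J.oddPow z (n + 1)) + ((a : ℂ) / 2) • C := by
      intro a
      induction a with
      | zero =>
        intro b hb
        obtain rfl : b = n + 1 := by omega
        simp [oddPow_zero]
      | succ a iha =>
        intro b hb
        rw [hstep a b (by omega), iha (b + 1) (by omega)]
        push_cast
        module
    -- `T_commutator_left` gives `C = T(z³, z^(2n+1)) - T(z^(2n+3), z)`. By `hall` this equals `C/2
    -- - (n+1) C/2 = -(n/2) C`.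
    have hC0 : C = 0 := by
      have h := J.T_commutator_left z z (J.oddPow z n)
      have h1 : J.triple z (J.oddPow z n) z = (2 : ℂ) • J.oddPow z (n + 1) := by
        rw [← T_apply, ← ih n 0 rfl, oddPow_zero, T_apply, J.triple_symm, ← T_apply,
          T_self_oddPow]
      have h2 : J.triple z z z = (2 : ℂ) • J.oddPow z 1 := J.T_self_oddPow z 0
      rw [← hC, h1, h2, T_smul_left, T_smul_left, hall 1 n (by omega)] at h
      have h3 := hall (n + 1) 0 (by omega)
      rw [oddPow_zero] at h3
      rw [h3] at h
      have h4 : ((n : ℂ) / 2 + 1) • C = 0 := by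
        push_cast at h
        linear_combination (norm := module) h
      refine (smul_eq_zero.1 h4).resolve_left ?_
      intro h5
      have h6 : ((n / 2 + 1 : ℝ) : ℂ) = 0 := by push_cast; exact h5
      have h7 : (n / 2 + 1 : ℝ) = 0 := by exact_mod_cast h6
      have h8 : (0 : ℝ) < n / 2 + 1 := by positivity
      exact h8.ne' h7
    intro a b hab
    rw [hall a b hab, hC0, smul_zero, add_zero]

/-- The odd powers of `z` span the Jordan subtriple generated by `z`. -/
noncomputable def cyc (z : V) : Submodule ℂ V := Submodule.span ℂ (Set.range (J.oddPow z))

theorem mem_cyc (z : V) : z ∈ J.cyc z := Submodule.subset_span ⟨0, rfl⟩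

theorem halfT_mem_cyc {z x : V} (hx : x ∈ J.cyc z) : J.halfT z x ∈ J.cyc z := by
  induction hx using Submodule.span_induction with
  | mem x h =>
    obtain ⟨k, rfl⟩ := h
    rw [← oddPow_succ]
    exact Submodule.subset_span ⟨k + 1, rfl⟩
  | zero => simp
  | add x y _ _ hx hy => rw [map_add]; exact add_mem hx hy
  | smul c x _ hx => rw [map_smul]; exact Submodule.smul_mem _ _ hx

/-- On odd powers both sides depend only on the sum of the indices. This makes eigenvectors of
`halfT z` in `cyc z` with different eigenvalues orthogonal as Jordan elements. -/
theorem T_halfT_left {z x y : V} (hx : x ∈ J.cyc z) (hy : y ∈ J.cyc z) :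
    J.T (J.halfT z x) y = J.T x (J.halfT z y) := by
  induction hx using Submodule.span_induction with
  | zero => simp [T_zero_left]
  | add x x' _ _ hx hx' => simp only [map_add, T_add_left, hx, hx']
  | smul c x _ hx => simp only [map_smul, T_smul_left, hx]
  | mem x h =>
    obtain ⟨a, rfl⟩ := h
    induction hy using Submodule.span_induction with
    | zero => simp [T_zero_right]
    | add x x' _ _ hx hx' => simp only [map_add, T_add_right, hx, hx']
    | smul c x _ hx => simp only [map_smul, T_smul_right, hx]
    | mem y h =>
      obtain ⟨b, rfl⟩ := h
      rw [← oddPow_succ, ← oddPow_succ, J.T_oddPow_aux z (a + b + 1) _ _ (by omega),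
        J.T_oddPow_aux z (a + b + 1) _ _ (by omega)]

theorem form_T (x u v : V) : J.form (J.T x x u) v = J.form u (J.T x x v) :=
  J.form_triple x x u v

theorem form_smul_right (c : ℂ) (x y : V) : J.form x (c • y) = conj c * J.form x y := by
  simp [form, T]

theorem form_self_ne_zero {x : V} (hx : x ≠ 0) : J.form x x ≠ 0 := fun h => by
  have := (J.trace_pos x hx).1
  rw [show LinearMap.trace ℂ V (J.triple x x) = J.form x x from rfl, h] at this
  simp at this

theorem core_inner_T (x u v : V) : J.core.inner (J.T x x u) v = J.core.inner u (J.T x x v) :=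
  (J.form_T x v u).symm

theorem form_halfT (z u v : V) : J.form (J.halfT z u) v = J.form u (J.halfT z v) := by
  simp only [halfT, LinearMap.smul_apply, form_smul_left, form_smul_right, form_T,
    map_div₀, map_one, map_ofNat]

/-- The eigenvalues of `T(x, x)` if `{x, x, x} = 2 μ x`. -/
theorem peirce_eigenvalue {x v : V} {μ t : ℂ} (hx : J.triple x x x = (2 * μ) • x)
    (hv : v ≠ 0) (h : J.T x x v = t • v) : t = 0 ∨ t = μ ∨ t = 2 * μ := by
  have h' : J.triple x x v = t • v := h
  have h1 := J.two_triple_triple x x x v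
  have h2 := J.triple_comm_outer x x (J.triple x v x)
  set q := J.triple x (J.triple x v x) x with hq
  rw [hx, h', map_smul, map_smul, LinearMap.smul_apply, LinearMap.smul_apply, h'] at h1
  have hqv : q = (2 * t ^ 2 - 2 * μ * t) • v := by
    linear_combination (norm := module) -h1
  rw [hx, map_smul, ← hq, hqv, map_smul, h'] at h2
  -- `triple_comm_outer` gives `T(x, x) q = 2 μ q`, while `q` is a multiple of `v` and so has
  -- eigenvalue `t`. Hence `q = 0` or `t = 2 μ`.
  have h3 : (2 * t ^ 2 - 2 * μ * t) * (t - 2 * μ) = 0 := by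
    refine (smul_eq_zero.1 (?_ : _ • v = 0)).resolve_right hv
    linear_combination (norm := module) h2
  have h4 : t * ((t - μ) * (t - 2 * μ)) = 0 := by linear_combination h3 / 2
  rcases mul_eq_zero.1 h4 with h | h
  · exact Or.inl h
  · rcases mul_eq_zero.1 h with h | h
    · exact Or.inr (Or.inl (sub_eq_zero.1 h))
    · exact Or.inr (Or.inr (sub_eq_zero.1 h))

/-- If `μ ≤ 0`, all eigenvalues `0, μ, 2μ` of `T(x, x)` would be nonpositive, against the positivity
of its trace. -/
theorem pos_of_triple_self {x : V} (hx0 : x ≠ 0) {μ : ℝ}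
    (hx : J.triple x x x = (2 * (μ : ℂ)) • x) : 0 < μ := by
  by_contra hμ
  have h := core_trace_nonpos J.core (J.core_inner_T x) fun r v hv hr => by
    rcases J.peirce_eigenvalue hx hv hr with h | h | h
    · exact (by exact_mod_cast h : r = 0).le
    · have : r = μ := by exact_mod_cast h
      linarith
    · have : r = 2 * μ := by exact_mod_cast h
      linarith
  exact absurd (J.trace_pos x hx0).1 (not_lt.2 h)

/-- A family of mutually orthogonal nonzero tripotents. -/
structure IsFrame {ι : Type*} (e : ι → V) : Prop where
  ne_zero : ∀ i, e i ≠ 0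
  triple_self : ∀ i, J.triple (e i) (e i) (e i) = (2 : ℂ) • e i
  orth : ∀ i j, i ≠ j → J.T (e i) (e j) = 0

/-- The spectral theorem: every element is a positive combination of orthogonal tripotents. -/
theorem exists_spectral (z : V) : ∃ (s : Finset ℂ) (e : s → V) (lam : s → ℝ),
    J.IsFrame e ∧ (∀ i, 0 < lam i) ∧ z = ∑ i, (lam i : ℂ) • e i := by
  have hsymm : ∀ x y, J.core.inner (J.halfT z x) y = J.core.inner x (J.halfT z y) :=
    fun x y => (J.form_halfT z y x).symm
  -- As `cyc z` is invariant under `halfT z`, the eigencomponents `f μ` of `z` stay in it, and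
  -- `T_halfT_left` applies to them.
  have hW := Submodule.eq_iSup_inf_genEigenspace (k := 1) (p := J.cyc z) (f := J.halfT z)
    (fun x hx => J.halfT_mem_cyc hx) (core_iSup_eigenspace_eq_top J.core hsymm)
  have hz := J.mem_cyc z
  rw [hW] at hz
  obtain ⟨f, hf, hsum⟩ := (Submodule.mem_iSup_iff_exists_finsupp _ _).1 hz
  have hfc : ∀ μ, f μ ∈ J.cyc z := fun μ => (hf μ).1
  have hfe : ∀ μ, J.halfT z (f μ) = μ • f μ := fun μ => Module.End.mem_eigenspace_iff.1 (hf μ).2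
  have horth : ∀ μ ν, μ ≠ ν → J.T (f μ) (f ν) = 0 := by
    intro μ ν hne
    by_cases hν : f ν = 0
    · rw [hν, T_zero_right]
    have hreal : conj ν = ν := by
      have h := J.form_halfT z (f ν) (f ν)
      rw [hfe, form_smul_left, form_smul_right] at h
      exact (mul_right_cancel₀ (J.form_self_ne_zero hν) h).symm
    have h := J.T_halfT_left (hfc μ) (hfc ν)
    rw [hfe, hfe, T_smul_left, T_smul_right, hreal, ← sub_eq_zero, ← sub_smul] at h
    exact (smul_eq_zero.1 h).resolve_left (sub_ne_zero.2 hne)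
  -- By orthogonality `z` may be replaced by `f μ` in `T(z, f μ)` and `T(f μ, z)`. Hence `{f μ, f μ,
  -- f μ} = {z, z, f μ} = 2 μ f μ`.
  have htrip : ∀ μ, f μ ≠ 0 → J.triple (f μ) (f μ) (f μ) = (2 * μ) • f μ := by
    intro μ hμ
    have h1 : J.T z z (f μ) = (2 * μ) • f μ := by
      have := hfe μ
      rw [halfT, LinearMap.smul_apply] at this
      rw [mul_smul, ← this, smul_smul]
      norm_num
    have h2 : J.T z (f μ) = J.T (f μ) (f μ) := by
      conv_lhs => rw [← hsum, Finsupp.sum]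
      have : ∀ s : Finset ℂ, J.T (∑ ν ∈ s, f ν) (f μ) = ∑ ν ∈ s, J.T (f ν) (f μ) := by
        intro s
        simp [T]
      rw [this, Finset.sum_eq_single μ (fun ν _ hne => horth ν μ hne)]
      intro h
      exact absurd (Finsupp.notMem_support_iff.1 h) hμ
    have h3 : J.T z z (f μ) = J.T (f μ) z z := J.triple_symm _ _ _
    have h4 : J.T (f μ) z = J.T (f μ) (f μ) := by
      conv_lhs => rw [← hsum, Finsupp.sum]
      have : ∀ s : Finset ℂ, J.T (f μ) (∑ ν ∈ s, f ν) = ∑ ν ∈ s, J.T (f μ) (f ν) := by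
        intro s
        simp [T]
      rw [this, Finset.sum_eq_single μ (fun ν _ hne => horth μ ν hne.symm)]
      intro h
      exact absurd (Finsupp.notMem_support_iff.1 h) hμ
    rw [← h1, h3, h4]
    calc J.T (f μ) (f μ) (f μ) = J.T z (f μ) (f μ) := by rw [h2]
      _ = J.T (f μ) (f μ) z := J.triple_symm _ _ _
  have hpos : ∀ μ, f μ ≠ 0 → 0 < μ.re ∧ (μ.re : ℂ) = μ := by
    intro μ hμ
    have hreal : conj μ = μ := by
      have h := J.form_halfT z (f μ) (f μ)
      rw [hfe, form_smul_left, form_smul_right] at h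
      exact (mul_right_cancel₀ (J.form_self_ne_zero hμ) h).symm
    have hre : (μ.re : ℂ) = μ := Complex.conj_eq_iff_re.1 hreal
    refine ⟨J.pos_of_triple_self hμ (μ := μ.re) ?_, hre⟩
    rw [hre]
    exact htrip μ hμ
  have hne : ∀ i : f.support, f i ≠ 0 := fun i => Finsupp.mem_support_iff.1 i.2
  have hs0 : ∀ i : f.support, 0 < √(i : ℂ).re := fun i => Real.sqrt_pos.2 (hpos i (hne i)).1
  have hsq : ∀ i : f.support, ((√(i : ℂ).re : ℝ) : ℂ) * (√(i : ℂ).re : ℝ) = i := fun i => by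
    rw [← Complex.ofReal_mul, Real.mul_self_sqrt (hpos i (hne i)).1.le, (hpos i (hne i)).2]
  have hs0' : ∀ i : f.support, ((√(i : ℂ).re : ℝ) : ℂ) ≠ 0 := fun i => by
    exact_mod_cast (hs0 i).ne'
  -- Dividing `f μ` by `√μ` turns the factor `2 μ` into 2, so `√μ` is the spectral value.
  refine ⟨f.support, fun i => ((√(i : ℂ).re : ℝ) : ℂ)⁻¹ • f i, fun i => √(i : ℂ).re,
    ⟨fun i => ?_, fun i => ?_, fun i j hij => ?_⟩, hs0, ?_⟩
  · exact smul_ne_zero (inv_ne_zero (hs0' i)) (hne i)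
  · set c : ℂ := ((√(i : ℂ).re : ℝ) : ℂ) with hc
    have hcc : conj c⁻¹ = c⁻¹ := by rw [map_inv₀, hc, Complex.conj_ofReal]
    rw [← T_apply, T_smul_left, T_smul_right, hcc, LinearMap.smul_apply, LinearMap.smul_apply,
      map_smul, T_apply, htrip i (hne i), ← hsq i, ← hc, smul_smul, smul_smul, smul_smul,
      smul_smul]
    congr 1
    have := hs0' i
    rw [← hc] at this
    field_simp
  · rw [T_smul_left, T_smul_right, horth _ _ (fun h => hij (Subtype.ext h)), smul_zero, smul_zero]
  · conv_lhs => rw [← hsum, Finsupp.sum, ← Finset.sum_coe_sort]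
    refine Finset.sum_congr rfl fun i _ => ?_
    rw [smul_smul, mul_inv_cancel₀ (hs0' i), one_smul]

/-! ### The joint Peirce decomposition of a frame -/

namespace IsFrame

variable {J} {ι : Type*} {e : ι → V}

theorem T_apply_other (h : J.IsFrame e) {i j : ι} (hij : i ≠ j) : J.T (e i) (e i) (e j) = 0 := by
  rw [T_apply, J.triple_symm, ← T_apply, h.orth j i hij.symm, LinearMap.zero_apply]

theorem commute (h : J.IsFrame e) (i j : ι) : Commute (J.T (e i) (e i)) (J.T (e j) (e j)) := by
  by_cases hij : i = j
  · rw [hij]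
  · refine sub_eq_zero.1 ?_
    rw [T_commutator, h.T_apply_other hij, T_zero_left, T_zero_right, sub_zero]

/-- `e i` lies in the Peirce space `V_ii`; the coefficient is kept in the form of `joint_eigenvalue`
so that the formulas on `V_ij` apply directly. -/
theorem T_self_apply [DecidableEq ι] (h : J.IsFrame e) (i k : ι) : J.T (e k) (e k) (e i) =
    (((if some i = some k then 1 else 0) + if some i = some k then 1 else 0 : ℂ)) • e i := by
  by_cases hk : i = k
  · subst hk
    rw [T_apply, h.triple_self]
    norm_num
  · rw [h.T_apply_other (Ne.symm hk)]
    simp [hk]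

variable [Fintype ι]

/-- The combination of the elements of a family with real coefficients. -/
noncomputable def comb (e : ι → V) (a : ι → ℝ) : V := ∑ i, (a i : ℂ) • e i

theorem T_comb (h : J.IsFrame e) (a b : ι → ℝ) :
    J.T (comb e a) (comb e b) = ∑ i, ((a i * b i : ℝ) : ℂ) • J.T (e i) (e i) := by
  have h1 : J.T (comb e a) (comb e b)
      = ∑ i, ∑ j, ((a i : ℂ) * (b j : ℂ)) • J.T (e i) (e j) := by
    simp only [T, comb, map_sum, map_smul, map_smulₛₗ, LinearMap.sum_apply, LinearMap.smul_apply,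
      Finset.smul_sum, smul_smul, Complex.conj_ofReal]
    rw [Finset.sum_comm]
    exact Finset.sum_congr rfl fun i _ => Finset.sum_congr rfl fun j _ => by rw [mul_comm]
  rw [h1]
  refine Finset.sum_congr rfl fun i _ => ?_
  rw [Finset.sum_eq_single i]
  · push_cast; rfl
  · intro j _ hj
    rw [h.orth i j hj.symm, smul_zero]
  · simp

theorem T_comb_comb (h : J.IsFrame e) (a b c : ι → ℝ) :
    J.T (comb e a) (comb e b) (comb e c) = (2 : ℂ) • comb e (fun i => a i * b i * c i) := by
  rw [h.T_comb, comb, comb]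
  simp only [LinearMap.sum_apply, LinearMap.smul_apply, map_sum, map_smul, Finset.smul_sum]
  refine Finset.sum_congr rfl fun i _ => ?_
  rw [Finset.sum_eq_single i]
  · rw [T_apply, h.triple_self, smul_smul, smul_smul, smul_smul]
    congr 1
    push_cast
    ring
  · intro j _ hj
    rw [h.T_apply_other hj, smul_zero, smul_zero]
  · simp

variable [DecidableEq ι]

/-- The joint eigenvalues of the operators `T(e i, e i)` of a frame. -/
theorem joint_eigenvalue (h : J.IsFrame e) {x : V} (hx : x ≠ 0) {t : ι → ℂ}
    (ht : ∀ k, J.T (e k) (e k) x = t k • x) :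
    ∃ i j : Option ι, ∀ k, t k = (if i = some k then 1 else 0) + if j = some k then 1 else 0 := by
  -- The sum of the `e k` over `s` is again a tripotent, so `peirce_eigenvalue` with `μ = 1` bounds
  -- every partial sum of the `t k` to 0, 1 or 2. Sets of at most three elements suffice for the
  -- pattern.
  have key : ∀ s : Finset ι, ∑ k ∈ s, t k = 0 ∨ ∑ k ∈ s, t k = 1 ∨ ∑ k ∈ s, t k = 2 := by
    intro s
    have h1 := h.T_comb_comb (fun i => if i ∈ s then 1 else 0) (fun i => if i ∈ s then 1 else 0)
      (fun i => if i ∈ s then 1 else 0)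
    have h2 := LinearMap.congr_fun (h.T_comb (fun i => if i ∈ s then 1 else 0)
      (fun i => if i ∈ s then 1 else 0)) x
    have h3 := J.peirce_eigenvalue (x := comb e fun i => if i ∈ s then 1 else 0) (μ := 1)
      (t := ∑ k ∈ s, t k) (v := x) ?_ hx ?_
    · simpa using h3
    · rw [← T_apply, h1]
      congr 1
      · norm_num
      · congr 1
        ext i
        split_ifs <;> norm_num
    · rw [h2, LinearMap.sum_apply, Finset.sum_smul]
      rw [← Finset.sum_filter_add_sum_filter_not Finset.univ (· ∈ s)]
      have hz : ∑ i ∈ Finset.univ.filter (fun i => i ∉ s),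
          ((((if i ∈ s then 1 else 0) * (if i ∈ s then 1 else 0) : ℝ) : ℂ) • J.T (e i) (e i)) x
            = 0 := by
        refine Finset.sum_eq_zero fun i hi => ?_
        rw [if_neg (Finset.mem_filter.1 hi).2]
        simp
      rw [hz, add_zero]
      rw [show Finset.univ.filter (fun i => i ∈ s) = s by ext; simp]
      refine Finset.sum_congr rfl fun i hi => ?_
      rw [if_pos hi]
      simp [ht]
  have h1 : ∀ k, t k = 0 ∨ t k = 1 ∨ t k = 2 := fun k => by simpa using key {k}
  have h2 : ∀ i j, i ≠ j → t i + t j = 0 ∨ t i + t j = 1 ∨ t i + t j = 2 := fun i j hij => by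
    simpa [Finset.sum_pair hij] using key {i, j}
  have h3 : ∀ i j k, i ≠ j → i ≠ k → j ≠ k →
      t i + (t j + t k) = 0 ∨ t i + (t j + t k) = 1 ∨ t i + (t j + t k) = 2 := by
    intro i j k hij hik hjk
    have := key {i, j, k}
    rwa [Finset.sum_insert (by simp [hij, hik]), Finset.sum_pair hjk] at this
  by_cases h0 : ∀ k, t k = 0
  · exact ⟨none, none, fun k => by simp [h0 k]⟩
  push Not at h0
  obtain ⟨i, hi⟩ := h0
  have hi' := (h1 i).resolve_left hi
  rcases hi' with hi1 | hi2
  · by_cases h00 : ∀ j, j ≠ i → t j = 0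
    · refine ⟨some i, none, fun k => ?_⟩
      by_cases hk : i = k
      · subst hk; simp [hi1]
      · simp [hk, h00 k (Ne.symm hk)]
    push Not at h00
    obtain ⟨j, hji, hj⟩ := h00
    have hj1 : t j = 1 := by
      rcases (h1 j).resolve_left hj with hj | hj
      · exact hj
      · have := h2 i j hji.symm
        rw [hi1, hj] at this
        norm_num at this
    refine ⟨some i, some j, fun k => ?_⟩
    by_cases hk : i = k
    · subst hk; simp [hi1, hji]
    by_cases hk' : j = k
    · subst hk'; simp [hj1, hk]
    have h3' := h3 i j k hji.symm hk hk'
    rw [hi1, hj1] at h3'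
    rcases h1 k with h | h | h
    · simp [h, hk, hk']
    · rw [h] at h3'; norm_num at h3'
    · rw [h] at h3'; norm_num at h3'
  · refine ⟨some i, some i, fun k => ?_⟩
    by_cases hk : i = k
    · subst hk; simp [hi2]; norm_num
    have h2' := h2 i k hk
    rw [hi2] at h2'
    rcases h1 k with h | h | h
    · simp [h, hk]
    · rw [h] at h2'; norm_num at h2'
    · rw [h] at h2'; norm_num at h2'

/-- Extension of a function by zero at `none`. -/
def ext0 (c : ι → ℝ) (i : Option ι) : ℝ := i.elim 0 c

theorem sum_pattern (c : ι → ℝ) (i j : Option ι) :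
    ∑ k, (c k : ℂ) * ((if i = some k then 1 else 0) + if j = some k then 1 else 0) =
      ext0 c i + ext0 c j := by
  have h : ∀ i : Option ι, ∑ k, (c k : ℂ) * (if i = some k then 1 else 0) = ext0 c i := by
    intro i
    cases i with
    | none => simp [ext0]
    | some i => simp [ext0]
  simp only [mul_add, Finset.sum_add_distrib, h]

theorem T_comb_apply (h : J.IsFrame e) {x : V} {i j : Option ι}
    (ht : ∀ k, J.T (e k) (e k) x =
      (((if i = some k then 1 else 0) + if j = some k then 1 else 0 : ℂ)) • x) (a b : ι → ℝ) :
    J.T (comb e a) (comb e b) x =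
      ((ext0 (fun k => a k * b k) i + ext0 (fun k => a k * b k) j : ℝ) : ℂ) • x := by
  rw [h.T_comb, LinearMap.sum_apply]
  simp only [LinearMap.smul_apply, ht, smul_smul]
  rw [← Finset.sum_smul, sum_pattern (fun k => a k * b k)]
  push_cast
  rfl

/-- With `p = a b`, `bergman_eq` yields `1 - (p_i + p_j) + ½ ((p_i + p_j)² - (p_i² + p_j²)) = (1 -
p_i)(1 - p_j)`. -/
theorem bergman_comb_apply (h : J.IsFrame e) {x : V} {i j : Option ι}
    (ht : ∀ k, J.T (e k) (e k) x =
      (((if i = some k then 1 else 0) + if j = some k then 1 else 0 : ℂ)) • x) (a b : ι → ℝ) :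
    J.B (comb e a) (comb e b) x =
      (((1 - ext0 (fun k => a k * b k) i) * (1 - ext0 (fun k => a k * b k) j) : ℝ) : ℂ) • x := by
  have h1 : (1 / 2 : ℂ) • J.triple (comb e a) (comb e b) (comb e a)
      = comb e (fun k => a k * b k * a k) := by
    rw [← T_apply, h.T_comb_comb, smul_smul]
    norm_num
  have h2 : ∀ i : Option ι, ext0 (fun k => a k * b k * a k * b k) i =
      ext0 (fun k => a k * b k) i ^ 2 := by
    intro i
    cases i with
    | none => simp [ext0]
    | some i => simp [ext0]; ring
  rw [bergman_eq, h1]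
  simp only [LinearMap.add_apply, LinearMap.sub_apply, LinearMap.smul_apply, Module.End.mul_apply,
    Module.End.one_apply, h.T_comb_apply ht, map_smul, h2]
  push_cast
  module

theorem linearMap_ext (h : J.IsFrame e) {A A' : V →ₗ[ℂ] V}
    (hA : ∀ (i j : Option ι) (x : V), (∀ k, J.T (e k) (e k) x =
      (((if i = some k then 1 else 0) + if j = some k then 1 else 0 : ℂ)) • x) → A x = A' x) :
    A = A' := by
  refine core_linearMap_ext J.core (fun i => J.core_inner_T (e i)) h.commute fun χ x hx hχ => ?_
  obtain ⟨i, j, hij⟩ := h.joint_eigenvalue hx hχ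
  exact hA i j x fun k => by rw [hχ k, hij k]

theorem isPosDef (h : J.IsFrame e) {A : V →ₗ[ℂ] V} (r : Option ι → Option ι → ℝ)
    (hr : ∀ i j, 0 < r i j)
    (hA : ∀ (i j : Option ι) (x : V), (∀ k, J.T (e k) (e k) x =
      (((if i = some k then 1 else 0) + if j = some k then 1 else 0 : ℂ)) • x) →
      A x = (r i j : ℂ) • x) : J.IsPosDef A := by
  refine core_posDef_of_joint J.core (fun i => J.core_inner_T (e i)) h.commute fun χ => ?_
  by_cases hχ : ∃ x, x ≠ 0 ∧ ∀ k, J.T (e k) (e k) x = χ k • x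
  · obtain ⟨x, hx0, hx⟩ := hχ
    obtain ⟨i, j, hij⟩ := h.joint_eigenvalue hx0 hx
    exact ⟨r i j, hr i j, fun y hy => hA i j y fun k => by rw [hy k, hij k]⟩
  · push Not at hχ
    -- This joint eigenspace is zero, so any positive number serves.
    refine ⟨1, one_pos, fun x hx => ?_⟩
    by_cases hx0 : x = 0
    · simp [hx0]
    · obtain ⟨k, hk⟩ := hχ x hx0
      exact absurd (hx k) hk

end IsFrame

/-! ### Continuity of the triple product -/

/-- The triple product as a continuous real bilinear map to the complex linear operators. -/
noncomputable def TL : V →L[ℝ] V →L[ℝ] (V →L[ℂ] V) :=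
  LinearMap.toContinuousLinearMap
    ((LinearMap.toContinuousLinearMap (𝕜 := ℝ) (E := V) (F' := V →L[ℂ] V)).toLinearMap ∘ₗ
      LinearMap.mk₂ ℝ (fun x y => LinearMap.toContinuousLinearMap (J.T x y))
        (fun x x' y => by rw [T_add_left, map_add])
        (fun c x y => by
          rw [← Complex.coe_smul, T_smul_left, map_smul, Complex.coe_smul])
        (fun x y y' => by rw [T_add_right, map_add])
        (fun c x y => by
          rw [← Complex.coe_smul, T_smul_right, map_smul, Complex.conj_ofReal, Complex.coe_smul]))

theorem TL_apply (x y z : V) : J.TL x y z = J.triple x y z := rfl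

theorem continuous_triple {X : Type*} [TopologicalSpace X] {f g h : X → V} (hf : Continuous f)
    (hg : Continuous g) (hh : Continuous h) : Continuous fun a => J.triple (f a) (g a) (h a) := by
  have : Continuous fun a => J.TL (f a) (g a) (h a) := by fun_prop
  exact this

theorem continuous_form {X : Type*} [TopologicalSpace X] {f g : X → V} (hf : Continuous f)
    (hg : Continuous g) : Continuous fun a => J.form (f a) (g a) := by
  have h1 : Continuous fun A : V →L[ℂ] V => LinearMap.trace ℂ V (A : V →ₗ[ℂ] V) :=
    LinearMap.continuous_of_finiteDimensional
      ((LinearMap.trace ℂ V) ∘ₗ (ContinuousLinearMap.coeLM ℂ : (V →L[ℂ] V) →ₗ[ℂ] (V →ₗ[ℂ] V)))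
  have : Continuous fun a => J.TL (f a) (g a) := by fun_prop
  exact h1.comp this

theorem form_self_re_pos {x : V} (hx : x ≠ 0) : 0 < (J.form x x).re := (J.trace_pos x hx).1

theorem form_sub_left (x y z : V) : J.form (x - y) z = J.form x z - J.form y z := by
  simp [form, T]

theorem form_sub_right (x y z : V) : J.form x (y - z) = J.form x y - J.form x z := by
  simp [form, T]

theorem form_neg_left (x z : V) : J.form (-x) z = - J.form x z := by
  simp [form, T]

/-! ### The spectral unit ball -/

/-- The spectral unit ball, described by `½ T(u, u) < 1`. -/
def specBall : Set V := {u | J.IsPosDef (1 - J.halfT u)}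

theorem im_form_halfT (u x : V) : (J.form ((1 - J.halfT u) x) x).im = 0 := by
  have h : conj (J.form ((1 - J.halfT u) x) x) = J.form ((1 - J.halfT u) x) x := by
    rw [form_conj]
    simp only [LinearMap.sub_apply, Module.End.one_apply, form_sub_left, form_sub_right,
      form_halfT]
  exact Complex.conj_eq_iff_im.1 h

theorem continuous_form_halfT :
    Continuous fun p : V × V => (J.form ((1 - J.halfT p.1) p.2) p.2).re := by
  refine Complex.continuous_re.comp (J.continuous_form ?_ continuous_snd)
  exact continuous_snd.sub
    ((J.continuous_triple continuous_fst continuous_fst continuous_snd).const_smul _)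

/-- By homogeneity positivity need only be tested on the unit sphere, and compactness makes it
stable under small changes of `u`. -/
theorem isOpen_specBall : IsOpen J.specBall := by
  rw [isOpen_iff_mem_nhds]
  intro u hu
  have hev : ∀ᶠ y in nhds u, ∀ x ∈ Metric.sphere (0 : V) 1,
      0 < (J.form ((1 - J.halfT y) x) x).re := by
    refine (isCompact_sphere (0 : V) 1).eventually_forall_of_forall_eventually fun x hx => ?_
    have hx0 : x ≠ 0 := fun h => by simp [h] at hx
    exact J.continuous_form_halfT.continuousAt.eventually (lt_mem_nhds (hu x hx0).1)
  filter_upwards [hev] with y hy x hx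
  refine ⟨?_, J.im_form_halfT y x⟩
  have hn : 0 < ‖x‖ := norm_pos_iff.2 hx
  have h1 := hy (((‖x‖⁻¹ : ℝ) : ℂ) • x) (by
    rw [mem_sphere_zero_iff_norm, norm_smul, Complex.norm_real, norm_inv, norm_norm,
      inv_mul_cancel₀ hn.ne'])
  rw [map_smul, form_smul_left, form_smul_right, Complex.conj_ofReal, ← mul_assoc,
    ← Complex.ofReal_mul, Complex.re_ofReal_mul] at h1
  exact pos_of_mul_pos_right h1 (by positivity)

theorem zero_mem_specBall : (0 : V) ∈ J.specBall := fun x hx => by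
  rw [halfT, T_zero_left, smul_zero, sub_zero]
  exact J.trace_pos x hx

theorem halfT_smul (c : ℂ) (u : V) : J.halfT (c • u) = ((‖c‖ ^ 2 : ℝ) : ℂ) • J.halfT u := by
  rw [halfT, halfT, T_smul_left, T_smul_right, smul_smul, smul_smul, smul_smul]
  congr 1
  rw [mul_assoc, Complex.mul_conj']
  push_cast
  ring

theorem smul_mem_specBall {c : ℂ} (hc : ‖c‖ ≤ 1) {u : V} (hu : u ∈ J.specBall) :
    c • u ∈ J.specBall := by
  intro x hx
  refine ⟨?_, J.im_form_halfT _ x⟩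
  have h1 := (hu x hx).1
  have h2 := J.form_self_re_pos hx
  simp only [LinearMap.sub_apply, Module.End.one_apply, form_sub_left, Complex.sub_re] at h1 ⊢
  rw [halfT_smul, LinearMap.smul_apply, form_smul_left, Complex.re_ofReal_mul]
  have h3 : ‖c‖ ^ 2 ≤ 1 := pow_le_one₀ (norm_nonneg c) hc
  rcases h3.lt_or_eq with h3 | h3
  · nlinarith [sq_nonneg ‖c‖]
  · rwa [h3, one_mul]

theorem isPreconnected_specBall : IsPreconnected J.specBall := by
  have h : StarConvex ℝ 0 J.specBall := by
    rw [starConvex_zero_iff]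
    intro x hx a ha0 ha1
    rw [← Complex.coe_smul]
    exact J.smul_mem_specBall (by rwa [Complex.norm_real, Real.norm_of_nonneg ha0]) hx
  exact (h.isPathConnected J.zero_mem_specBall).isConnected.isPreconnected

/-- The self-adjoint operator `½ T(u, u) - 1` has negative eigenvalues, so its trace `½ (u | u) -
dim V` is at most 0. -/
theorem form_self_re_le {u : V} (hu : u ∈ J.specBall) :
    (J.form u u).re ≤ 2 * Module.finrank ℂ V := by
  have h := core_trace_nonpos J.core (L := J.halfT u - 1)
    (fun x y => by
      change J.form y ((J.halfT u - 1) x) = J.form ((J.halfT u - 1) y) x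
      rw [LinearMap.sub_apply, LinearMap.sub_apply, form_sub_left, form_halfT, ← form_conj,
        form_sub_left, map_sub, form_conj, form_conj]; rfl)
    (fun r x hx hr => by
      have h1 := (hu x hx).1
      have h2 := J.form_self_re_pos hx
      rw [← neg_sub, LinearMap.neg_apply, hr, form_neg_left, form_smul_left, Complex.neg_re,
        Complex.re_ofReal_mul] at h1
      nlinarith)
  rw [map_sub, LinearMap.trace_one, halfT, map_smul, Complex.sub_re, smul_eq_mul] at h
  change ((1 / 2 : ℂ) * J.form u u).re - _ ≤ 0 at h
  have h1 : ((1 / 2 : ℂ) * J.form u u).re = 1 / 2 * (J.form u u).re := by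
    rw [show (1 / 2 : ℂ) = ((1 / 2 : ℝ) : ℂ) by push_cast; rfl, Complex.re_ofReal_mul]
  rw [h1, Complex.natCast_re] at h
  linarith

theorem exists_norm_le : ∃ R : ℝ, 0 < R ∧ ∀ u ∈ J.specBall, ‖u‖ ≤ R := by
  obtain ⟨c, hc, hmin⟩ : ∃ c : ℝ, 0 < c ∧ ∀ x ∈ Metric.sphere (0 : V) 1, c ≤ (J.form x x).re := by
    have hcont : Continuous fun x => (J.form x x).re :=
      Complex.continuous_re.comp (J.continuous_form continuous_id continuous_id)
    rcases (Metric.sphere (0 : V) 1).eq_empty_or_nonempty with h | h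
    · exact ⟨1, one_pos, fun x hx => by simp [h] at hx⟩
    · obtain ⟨x, hx, hm⟩ := (isCompact_sphere (0 : V) 1).exists_isMinOn h hcont.continuousOn
      exact ⟨_, J.form_self_re_pos fun h0 => by simp [h0] at hx, fun y hy => hm hy⟩
  have hle : ∀ x, c * ‖x‖ ^ 2 ≤ (J.form x x).re := by
    intro x
    by_cases hx : x = 0
    · simp [hx, form, T]
    have hn : 0 < ‖x‖ := norm_pos_iff.2 hx
    have h1 := hmin (((‖x‖⁻¹ : ℝ) : ℂ) • x) (by
      rw [mem_sphere_zero_iff_norm, norm_smul, Complex.norm_real, norm_inv, norm_norm,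
        inv_mul_cancel₀ hn.ne'])
    rw [form_smul_left, form_smul_right, Complex.conj_ofReal, ← mul_assoc,
      ← Complex.ofReal_mul, Complex.re_ofReal_mul] at h1
    calc c * ‖x‖ ^ 2 ≤ (‖x‖⁻¹ * ‖x‖⁻¹ * (J.form x x).re) * ‖x‖ ^ 2 := by gcongr
      _ = (J.form x x).re := by field_simp
  -- From `c ‖u‖² ≤ 2 dim V` and `‖u‖ ≤ ‖u‖² + 1`.
  refine ⟨(2 * Module.finrank ℂ V + c) / c, by positivity, fun u hu => ?_⟩
  have h1 := J.form_self_re_le hu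
  have h2 := hle u
  rw [le_div_iff₀ hc]
  have h3 : ‖u‖ ≤ ‖u‖ ^ 2 + 1 := by nlinarith [sq_nonneg (‖u‖ - 1), norm_nonneg u]
  nlinarith

namespace IsFrame

variable {J} {ι : Type*} {e : ι → V}

theorem ext0_lt_one {c : ι → ℝ} (hc : ∀ i, c i < 1) (i : Option ι) : ext0 c i < 1 := by
  cases i with
  | none => simp [ext0]
  | some i => exact hc i

variable [Fintype ι] [DecidableEq ι]

theorem isPosDef_bergman (h : J.IsFrame e) {a b : ι → ℝ} (hab : ∀ i, a i * b i < 1) :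
    J.IsPosDef (J.B (comb e a) (comb e b)) :=
  h.isPosDef
    (fun i j => (1 - ext0 (fun k => a k * b k) i) * (1 - ext0 (fun k => a k * b k) j))
    (fun i j => mul_pos (sub_pos.2 (ext0_lt_one hab i)) (sub_pos.2 (ext0_lt_one hab j)))
    fun _ _ _ ht => h.bergman_comb_apply ht a b

theorem halfT_apply (h : J.IsFrame e) (a : ι → ℝ) (i : ι) :
    J.halfT (comb e a) (e i) = ((a i ^ 2 : ℝ) : ℂ) • e i := by
  rw [halfT, LinearMap.smul_apply, h.T_comb_apply (h.T_self_apply i), smul_smul]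
  congr 1
  simp only [ext0, Option.elim]
  push_cast
  ring

theorem bergman_apply (h : J.IsFrame e) (a b : ι → ℝ) (i : ι) :
    J.B (comb e a) (comb e b) (e i) = (((1 - a i * b i) ^ 2 : ℝ) : ℂ) • e i := by
  rw [h.bergman_comb_apply (h.T_self_apply i)]
  congr 2
  simp only [ext0, Option.elim]
  ring

theorem comb_mem_specBall (h : J.IsFrame e) {a : ι → ℝ} :
    comb e a ∈ J.specBall ↔ ∀ i, a i ^ 2 < 1 := by
  constructor
  · intro hm i
    have h1 := (hm (e i) (h.ne_zero i)).1
    have h2 := J.form_self_re_pos (h.ne_zero i)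
    rw [LinearMap.sub_apply, h.halfT_apply, form_sub_left, Module.End.one_apply, form_smul_left,
      Complex.sub_re, Complex.re_ofReal_mul] at h1
    nlinarith
  · intro hm
    have hm' : ∀ i, a i * a i < 1 := fun i => by rw [← sq]; exact hm i
    refine h.isPosDef (fun i j => 1 - (ext0 (fun k => a k * a k) i +
      ext0 (fun k => a k * a k) j) / 2) (fun i j => ?_) fun i j x hx => ?_
    · have h1 := ext0_lt_one hm' i
      have h2 := ext0_lt_one hm' j
      linarith
    · rw [LinearMap.sub_apply, halfT, LinearMap.smul_apply, h.T_comb_apply hx,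
        Module.End.one_apply]
      push_cast
      module

theorem sq_le_one (h : J.IsFrame e) {a : ι → ℝ} (hm : comb e a ∈ closure J.specBall) (i : ι) :
    a i ^ 2 ≤ 1 := by
  have hc : Continuous fun u : V => (J.form ((1 - J.halfT u) (e i)) (e i)).re :=
    J.continuous_form_halfT.comp (g := fun p : V × V => (J.form ((1 - J.halfT p.1) p.2) p.2).re)
      (f := fun u : V => (u, e i)) (by fun_prop)
  have hcl : IsClosed {u : V | 0 ≤ (J.form ((1 - J.halfT u) (e i)) (e i)).re} :=
    isClosed_le continuous_const hc
  have h1 : comb e a ∈ {u : V | 0 ≤ (J.form ((1 - J.halfT u) (e i)) (e i)).re} :=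
    closure_minimal (fun u hu => (hu (e i) (h.ne_zero i)).1.le) hcl hm
  have h2 := J.form_self_re_pos (h.ne_zero i)
  rw [Set.mem_ofPred_eq, LinearMap.sub_apply, h.halfT_apply, form_sub_left, Module.End.one_apply,
    form_smul_left, Complex.sub_re, Complex.re_ofReal_mul] at h1
  nlinarith

end IsFrame

/-- The spectral ball is connected, contains 0 and lies in the positivity set. It is also relatively
closed in the component: a limit point has `λ_i² ≤ 1`, and `λ_i² = 1` would give `B(u, u) e_i = (1 -
λ_i²)² e_i = 0`. -/
theorem domain_eq_specBall : J.domain = J.specBall := by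
  have hsub : J.specBall ⊆ {u | J.IsPosDef (J.B u u)} := by
    intro u hu
    obtain ⟨s, e, lam, he, -, rfl⟩ := J.exists_spectral u
    exact he.isPosDef_bergman fun i => by
      rw [← sq]; exact he.comb_mem_specBall.1 hu i
  have h0 := J.zero_mem_specBall
  refine Set.Subset.antisymm ?_
    (J.isPreconnected_specBall.subset_connectedComponentIn h0 hsub)
  refine isPreconnected_connectedComponentIn.subset_of_closure_inter_subset J.isOpen_specBall
    ⟨0, mem_connectedComponentIn (hsub h0), h0⟩ ?_
  rintro u ⟨hu, hu'⟩
  have hB : J.IsPosDef (J.B u u) := connectedComponentIn_subset _ _ hu'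
  obtain ⟨s, e, lam, he, -, rfl⟩ := J.exists_spectral u
  refine he.comb_mem_specBall.2 fun i => lt_of_le_of_ne (he.sq_le_one hu i) fun h1 => ?_
  have h2 := (hB (e i) (he.ne_zero i)).1
  have h3 := he.bergman_apply lam lam i
  rw [← sq, h1, sub_self] at h3
  rw [show ∑ i, (lam i : ℂ) • e i = IsFrame.comb e lam from rfl, h3] at h2
  simp [form, T] at h2

theorem isPosDef_bergman_of_mem {z : V} (hz : z ∈ J.domain) : J.IsPosDef (J.B z z) :=
  connectedComponentIn_subset _ _ hz

/-! ### The symplectic duality map -/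

theorem symplecticDuality_eq {z : V} {S : V →ₗ[ℂ] V} (hz : J.IsPosDef (J.B z z))
    (hS : J.IsInvFourthRoot (J.B z z) S) : J.symplecticDuality z = S z := by
  rw [symplecticDuality, invFourthRoot, dif_pos hz,
    ← (J.existsUnique_invFourthRoot hz).choose_spec.2 S hS]

/-- All operators involved are scalar on each `V_ij` of a frame for `z`, and the scalars factor over
`i` and `j`. The claim becomes an identity in one spectral value. -/
theorem bergman_symplecticDuality {z : V} (hz : z ∈ J.domain) :
    J.B (J.symplecticDuality z) (-J.symplecticDuality z) * J.B z z = 1 := by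
  have hpos := J.isPosDef_bergman_of_mem hz
  rw [domain_eq_specBall] at hz
  obtain ⟨s, e, lam, he, -, hzc⟩ := J.exists_spectral z
  change z = IsFrame.comb e lam at hzc
  rw [hzc] at hz hpos
  have hlam := he.comb_mem_specBall.1 hz
  have hmul : ∀ {a b : ℝ}, a = 1 → b = 1 → a * b = 1 := by
    rintro _ _ rfl rfl
    exact one_mul 1
  have hcomb : ∀ S : V →ₗ[ℂ] V, S (IsFrame.comb e lam) = ∑ i, (lam i : ℂ) • S (e i) := by
    intro S
    rw [IsFrame.comb, map_sum]
    simp only [map_smul]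
  set g : s → ℝ := fun i => (1 - lam i ^ 2) ^ (-(1 / 4) : ℝ) with hg
  have hg0 : ∀ i, 0 < g i := fun i => Real.rpow_pos_of_pos (sub_pos.2 (hlam i)) _
  have hg4 : ∀ i, g i ^ 4 * (1 - lam i ^ 2) = 1 := by
    intro i
    have h0 := sub_pos.2 (hlam i)
    have h1 : g i ^ 4 = (1 - lam i ^ 2)⁻¹ := by
      rw [← Real.rpow_natCast, ← Real.rpow_mul h0.le, ← Real.rpow_neg_one]
      norm_num
    rw [h1, inv_mul_cancel₀ h0.ne']
  have hpat : ∀ i : Option s, (1 - IsFrame.ext0 (fun k => (1 - g k) * 1) i) ^ 4 *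
      (1 - IsFrame.ext0 (fun k => lam k * lam k) i) = 1 := by
    intro i
    cases i with
    | none => simp [IsFrame.ext0]
    | some i =>
      simp only [IsFrame.ext0, Option.elim]
      linear_combination hg4 i
  -- The fourth root is itself a Bergman operator: `B(∑ (1 - g_i) e_i, ∑ e_i)` acts on `V_ij` by
  -- `g_i g_j`, with `g_0 = 1`.
  have hS : J.IsInvFourthRoot (J.B (IsFrame.comb e lam) (IsFrame.comb e lam))
      (J.B (IsFrame.comb e fun i => 1 - g i) (IsFrame.comb e fun _ => 1)) := by
    refine ⟨he.isPosDef_bergman fun i => by linarith [hg0 i], he.linearMap_ext ?_⟩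
    intro i j x hx
    simp only [LinearMap.comp_apply, he.bergman_comb_apply hx, map_smul, smul_smul,
      LinearMap.id_apply]
    simp only [← Complex.ofReal_mul]
    conv_rhs => rw [← one_smul ℂ x, ← Complex.ofReal_one]
    congr 2
    linear_combination hmul (hpat i) (hpat j)
  -- Since `e_i` lies in `V_ii`, the fourth root multiplies it by `g_i²`.
  have hPsi : J.symplecticDuality z = IsFrame.comb e fun i => g i ^ 2 * lam i := by
    rw [hzc, J.symplecticDuality_eq hpos hS]
    rw [hcomb, IsFrame.comb.eq_def e fun i => g i ^ 2 * lam i]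
    refine Finset.sum_congr rfl fun i _ => ?_
    rw [he.bergman_apply, smul_smul]
    congr 1
    push_cast
    ring
  have hneg : -IsFrame.comb e (fun i => g i ^ 2 * lam i)
      = IsFrame.comb e fun i => -(g i ^ 2 * lam i) := by
    simp [IsFrame.comb]
  rw [hPsi, hneg, hzc]
  refine he.linearMap_ext fun i j x hx => ?_
  rw [Module.End.mul_apply, he.bergman_comb_apply hx, map_smul, he.bergman_comb_apply hx,
    smul_smul, ← Complex.ofReal_mul, Module.End.one_apply]
  -- From `g⁴ (1 - λ²) = 1` one gets `(1 + g⁴ λ²)(1 - λ²) = (1 - λ²) + λ² = 1`.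
  have hpat2 : ∀ i : Option s,
      (1 - IsFrame.ext0 (fun k => g k ^ 2 * lam k * -(g k ^ 2 * lam k)) i) *
        (1 - IsFrame.ext0 (fun k => lam k * lam k) i) = 1 := by
    intro i
    cases i with
    | none => simp [IsFrame.ext0]
    | some i =>
      simp only [IsFrame.ext0, Option.elim]
      linear_combination (lam i ^ 2) * hg4 i
  conv_rhs => rw [← one_smul ℂ x, ← Complex.ofReal_one]
  congr 2
  linear_combination hmul (hpat2 i) (hpat2 j)

end HPJTS

section

open MeasureTheory
open scoped Topology
set_option maxSynthPendingDepth 3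

/-- The Picard-Lindelöf theorem, together with the bound on the solution. -/
theorem IsPicardLindelof.exists_mem_closedBall {E : Type*} [NormedAddCommGroup E] [NormedSpace ℝ E]
    [CompleteSpace E] {f : ℝ → E → E} {tmin tmax : ℝ} {t₀ : Set.Icc tmin tmax} {x₀ : E}
    {a L K : NNReal} (hf : IsPicardLindelof f t₀ x₀ a 0 L K) :
    ∃ α : ℝ → E, α t₀ = x₀ ∧ (∀ t ∈ Set.Icc tmin tmax, α t ∈ Metric.closedBall x₀ a) ∧
      ∀ t ∈ Set.Icc tmin tmax, HasDerivWithinAt α (f t (α t)) (Set.Icc tmin tmax) t := by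
  have hx : x₀ ∈ Metric.closedBall x₀ ((0 : NNReal) : ℝ) := Metric.mem_closedBall_self le_rfl
  obtain ⟨α, hα⟩ := ODE.FunSpace.exists_isFixedPt_next hf hx
  refine ⟨α.compProj, by rw [ODE.FunSpace.compProj_val, ← hα, ODE.FunSpace.next_apply₀],
    fun t _ => α.compProj_mem_closedBall hf.mul_max_le, fun t ht ↦ ?_⟩
  apply ODE.hasDerivWithinAt_picard_Icc t₀.2 hf.continuousOn_uncurry
    α.continuous_compProj.continuousOn (fun _ ht' ↦ α.compProj_mem_closedBall hf.mul_max_le)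
    x₀ ht |>.congr_of_mem _ ht
  intro t' ht'
  nth_rw 1 [← hα]
  rw [ODE.FunSpace.compProj_of_mem ht', ODE.FunSpace.next_apply]

theorem HasDerivWithinAt.Ici_of_Icc {E : Type*} [NormedAddCommGroup E] [NormedSpace ℝ E]
    {f : ℝ → E} {f' : E} {a b t : ℝ} (h : HasDerivWithinAt f f' (Set.Icc a b) t)
    (ht : t ∈ Set.Ico a b) : HasDerivWithinAt f f' (Set.Ici t) t :=
  h.mono_of_mem_nhdsWithin (Icc_mem_nhdsGE_of_mem ht)

theorem clm_mul_apply {V : Type*} [NormedAddCommGroup V] [NormedSpace ℂ V]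
    (A A' : V →L[ℂ] V) (x : V) : (A * A') x = A (A' x) := rfl

theorem HasDerivWithinAt.complexClm_apply {V : Type*} [NormedAddCommGroup V] [NormedSpace ℂ V]
    {s : Set ℝ} {t : ℝ} {A : ℝ → V →L[ℂ] V} {A' : V →L[ℂ] V}
    {x : ℝ → V} {x' : V} (hA : HasDerivWithinAt A A' s t) (hx : HasDerivWithinAt x x' s t) :
    HasDerivWithinAt (fun t => A t (x t)) (A' (x t) + A t x') s t :=
  ((ContinuousLinearMap.restrictScalarsL ℂ V V ℝ ℝ).hasFDerivAt.comp_hasDerivWithinAt t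
    hA).clm_apply hx

namespace HPJTS

variable {V : Type*} [NormedAddCommGroup V] [NormedSpace ℂ V] [FiniteDimensional ℂ V]
  (J : HPJTS V)

/-! ### The derivative of the Bergman operator along a quadratic vector field -/

/-- The Bergman operator as a continuous linear map. -/
noncomputable def BL (x y : V) : V →L[ℂ] V :=
  1 - J.TL x y + (1 / 2 : ℝ) • (J.TL x y * J.TL x y - J.TL ((1 / 2 : ℝ) • J.TL x y x) y)

theorem coe_BL (x y : V) : (J.BL x y : V →ₗ[ℂ] V) = J.B x y := by
  rw [bergman_eq, BL]
  ext u
  have h : ∀ w : V, (1 / 2 : ℝ) • w = (1 / 2 : ℂ) • w := fun w => by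
    rw [← Complex.coe_smul]; norm_num
  simp only [ContinuousLinearMap.coe_coe, _root_.add_apply, _root_.sub_apply, _root_.smul_apply,
    clm_mul_apply, h, LinearMap.add_apply, LinearMap.sub_apply, LinearMap.smul_apply,
    Module.End.mul_apply]
  rfl

theorem BL_apply (x y u : V) :
    J.BL x y u = u - J.TL x y u + (1 / 4 : ℂ) • J.TL x (J.TL y u y) x := by
  have h := J.B_apply x y u
  rw [← coe_BL] at h
  exact h

/-- The quadratic vector field `z ↦ v - Q(z) v`. -/
noncomputable def field (v z : V) : V := v - (1 / 2 : ℝ) • J.TL z v z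

theorem TL_symm (x y z : V) : J.TL x y z = J.TL z y x := J.triple_symm x y z

theorem field_sub (v z w : V) : J.field v z - J.field v w =
    -(J.TL w v (z - w)) - (1 / 2 : ℝ) • J.TL (z - w) v (z - w) := by
  have h1 := J.TL_symm z v w
  simp only [field, map_sub, _root_.sub_apply]
  linear_combination (norm := module) -(1 / 2 : ℝ) • h1

/-- The left side is the product-rule derivative of `BL z w` when both points move along `field v`.
The right side is the infinitesimal form of `B(φ z, φ w) = φ'(z) B(z, w) φ'(w)*`, because `-T(z, v)`
is the derivative of the field at `z`. -/
theorem deriv_bergman_identity (v z w : V) :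
    -(J.TL (J.field v z) w + J.TL z (J.field v w)) +
      (1 / 2 : ℝ) • ((J.TL (J.field v z) w + J.TL z (J.field v w)) * J.TL z w +
        J.TL z w * (J.TL (J.field v z) w + J.TL z (J.field v w)) -
        (J.TL ((1 / 2 : ℝ) • ((J.TL (J.field v z) w + J.TL z (J.field v w)) z +
          J.TL z w (J.field v z))) w + J.TL ((1 / 2 : ℝ) • J.TL z w z) (J.field v w))) =
      -(J.TL z v * J.BL z w) - J.BL z w * J.TL v w := by
  ext u
  have hh : ∀ y : V, (1 / 2 : ℝ) • y = (1 / 2 : ℂ) • y := fun w => by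
    rw [← Complex.coe_smul]; norm_num
  have hc : conj (1 / 2 : ℂ) = 1 / 2 := by norm_num [Complex.ext_iff]
  -- `polar` and `polar'` are the derivatives of the identity for `Q(z) Q(w)` in `z` along `a` and
  -- in `w` along `b`.
  have polar : ∀ a, J.triple z w (J.triple a w u) + J.triple a w (J.triple z w u) -
      J.triple (J.triple z w a) w u = J.triple z (J.triple w u w) a := by
    intro a
    have h := J.jordan u w z w a
    rw [J.triple_symm u w (J.triple z w a), J.triple_symm u w a, J.triple_symm u w z,
      J.triple_symm (J.triple z w u) w a] at h
    linear_combination (norm := module) -h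
  have polar' : ∀ b, J.triple z b (J.triple z w u) + J.triple z w (J.triple z b u) -
      (1 / 2 : ℂ) • J.triple (J.triple z b z) w u -
      (1 / 2 : ℂ) • J.triple (J.triple z w z) b u = J.triple z (J.triple w u b) z := by
    intro b
    have h1 := J.two_triple_triple z b w u
    have h2 := J.two_triple_triple z w b u
    rw [J.triple_symm b u w] at h1
    linear_combination (norm := module) (1 / 2 : ℂ) • h1 + (1 / 2 : ℂ) • h2
  obtain ⟨a, ha⟩ : ∃ a, a = J.field v z := ⟨_, rfl⟩
  obtain ⟨b, hb⟩ : ∃ b, b = J.field v w := ⟨_, rfl⟩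
  have e1 := polar a
  have e2 := polar' b
  have ha' : a = v - (1 / 2 : ℂ) • J.triple z v z := by rw [ha, field, hh]; rfl
  have hb' : b = v - (1 / 2 : ℂ) • J.triple w v w := by rw [hb, field, hh]; rfl
  have i1 := J.two_triple_triple z v w u
  rw [J.triple_symm v u w] at i1
  have i2 := J.two_triple_triple_middle z w v u
  have i3 := J.triple_comm_outer z v (J.triple w u w)
  have i4 := congrArg (fun y => J.triple z y z) (J.triple_triple_inner w v u)
  have i5 := J.triple_symm a w z
  have hL : ((-(J.TL a w + J.TL z b) +
      (1 / 2 : ℝ) • ((J.TL a w + J.TL z b) * J.TL z w + J.TL z w * (J.TL a w + J.TL z b) -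
        (J.TL ((1 / 2 : ℝ) • ((J.TL a w + J.TL z b) z + J.TL z w a)) w +
          J.TL ((1 / 2 : ℝ) • J.TL z w z) b))) u) =
      -J.triple a w u - J.triple z b u + (1 / 2 : ℂ) • J.triple z (J.triple w u w) a +
        (1 / 2 : ℂ) • J.triple z (J.triple w u b) z := by
    rw [← e1, ← e2]
    simp only [map_smul, map_add, _root_.add_apply, _root_.neg_apply,
      _root_.smul_apply, _root_.sub_apply, clm_mul_apply,
      hh, TL_apply, i5,
      LinearMap.add_apply, LinearMap.smul_apply]
    module
  rw [← ha, ← hb, hL, ha', hb']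
  simp only [_root_.neg_apply, _root_.sub_apply,
    clm_mul_apply, BL_apply, TL_apply, map_sub, map_add, map_smul, map_smulₛₗ,
    LinearMap.sub_apply, LinearMap.smul_apply, hc]
  linear_combination (norm := module) -(1 / 2 : ℂ) • i1 - (1 / 2 : ℂ) • i2 + (1 / 4 : ℂ) • i3 +
    (1 / 4 : ℂ) • i4

section Deriv

variable {s : Set ℝ} {t : ℝ}

theorem hasDerivWithinAt_TL {z w : ℝ → V} {z' w' : V} (hz : HasDerivWithinAt z z' s t)
    (hw : HasDerivWithinAt w w' s t) :
    HasDerivWithinAt (fun t => J.TL (z t) (w t)) (J.TL z' (w t) + J.TL (z t) w') s t := by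
  have h : HasDerivWithinAt (fun t => J.TL (z t)) (J.TL z') s t :=
    J.TL.hasFDerivAt.comp_hasDerivWithinAt t hz
  exact h.clm_apply hw

theorem hasDerivWithinAt_BL {v : V} {z w : ℝ → V} (hz : HasDerivWithinAt z (J.field v (z t)) s t)
    (hw : HasDerivWithinAt w (J.field v (w t)) s t) :
    HasDerivWithinAt (fun t => J.BL (z t) (w t))
      (-(J.TL (z t) v * J.BL (z t) (w t)) - J.BL (z t) (w t) * J.TL v (w t)) s t := by
  have h1 := J.hasDerivWithinAt_TL hz hw
  have h2 := (h1.complexClm_apply hz).const_smul (1 / 2 : ℝ)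
  have h3 := J.hasDerivWithinAt_TL h2 hw
  have h4 := ((h1.mul h1).sub h3).const_smul (1 / 2 : ℝ)
  have h5 := (h1.const_sub 1).add h4
  rw [← deriv_bergman_identity]
  exact h5

end Deriv

/-! ### Adjoints with respect to the trace form -/

theorem eq_of_form_eq {x y : V} (h : ∀ u, J.form u x = J.form u y) : x = y := by
  by_contra hne
  have h1 := h (x - y)
  rw [← sub_eq_zero, ← form_sub_right] at h1
  exact J.form_self_ne_zero (sub_ne_zero.2 hne) h1

theorem exists_adjoint (A : V →L[ℂ] V) : ∃ A' : V →L[ℂ] V,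
    (∀ x y, J.form (A x) y = J.form x (A' y)) ∧
      LinearMap.det (A' : V →ₗ[ℂ] V) = conj (LinearMap.det (A : V →ₗ[ℂ] V)) := by
  obtain ⟨A', h1, h2⟩ := core_exists_adjoint J.core (A : V →ₗ[ℂ] V)
  refine ⟨LinearMap.toContinuousLinearMap A', fun x y => ?_, h2⟩
  rw [← form_conj, ← form_conj _ _ x]
  exact congrArg conj (h1 x y)

/-- The adjoint with respect to the trace form. -/
noncomputable def adj (A : V →L[ℂ] V) : V →L[ℂ] V := (J.exists_adjoint A).choose

theorem form_adj (A : V →L[ℂ] V) (x y : V) : J.form (A x) y = J.form x (J.adj A y) :=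
  (J.exists_adjoint A).choose_spec.1 x y

theorem det_adj (A : V →L[ℂ] V) :
    LinearMap.det (J.adj A : V →ₗ[ℂ] V) = conj (LinearMap.det (A : V →ₗ[ℂ] V)) :=
  (J.exists_adjoint A).choose_spec.2

theorem adj_eq {A A' : V →L[ℂ] V} (h : ∀ x y, J.form (A x) y = J.form x (A' y)) :
    J.adj A = A' := by
  ext y
  exact J.eq_of_form_eq fun u => by rw [← form_adj, h]

theorem form_add_right (x y z : V) : J.form x (y + z) = J.form x y + J.form x z := by
  simp [form, T]

theorem adj_add (A A' : V →L[ℂ] V) : J.adj (A + A') = J.adj A + J.adj A' :=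
  J.adj_eq fun x y => by
    simp only [_root_.add_apply, form_add_left, form_add_right, form_adj]

theorem adj_smul (c : ℝ) (A : V →L[ℂ] V) : J.adj (c • A) = c • J.adj A :=
  J.adj_eq fun x y => by
    simp only [_root_.smul_apply, ← Complex.coe_smul, form_smul_left,
      form_smul_right, form_adj, Complex.conj_ofReal]

theorem adj_mul (A A' : V →L[ℂ] V) : J.adj (A * A') = J.adj A' * J.adj A :=
  J.adj_eq fun x y => by
    simp only [clm_mul_apply, form_adj]

theorem adj_one : J.adj 1 = 1 := J.adj_eq fun _ _ => rfl

theorem adj_TL (x y : V) : J.adj (J.TL x y) = J.TL y x :=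
  J.adj_eq fun u v => J.form_triple x y u v

/-- The adjoint as a continuous real linear map. -/
noncomputable def adjL : (V →L[ℂ] V) →L[ℝ] (V →L[ℂ] V) :=
  LinearMap.toContinuousLinearMap (𝕜 := ℝ)
    { toFun := J.adj, map_add' := J.adj_add, map_smul' := J.adj_smul }

theorem adjL_apply (A : V →L[ℂ] V) : J.adjL A = J.adj A := rfl

/-! ### Flow lines -/

/-- Integral curves on the unit interval of the vector field `z ↦ v - Q(z) v`. -/
def IsFlowLine (v : V) (z : ℝ → V) : Prop :=
  ∀ t ∈ Set.Icc (0 : ℝ) 1, HasDerivWithinAt z (J.field v (z t)) (Set.Icc 0 1) t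

/-- The derivative of the flow along a flow line. -/
def IsTransport (v : V) (z : ℝ → V) (h : ℝ → V →L[ℂ] V) : Prop :=
  h 0 = 1 ∧ ∀ t ∈ Set.Icc (0 : ℝ) 1, HasDerivWithinAt h (-(J.TL (z t) v * h t)) (Set.Icc 0 1) t

theorem IsFlowLine.continuousOn {v : V} {z : ℝ → V} (hz : J.IsFlowLine v z) :
    ContinuousOn z (Set.Icc 0 1) := fun t ht => (hz t ht).continuousWithinAt

theorem norm_TL_le (x y : V) : ‖J.TL x y‖ ≤ ‖J.TL‖ * ‖x‖ * ‖y‖ := J.TL.le_opNorm₂ x y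

theorem norm_TL_apply_le (x y z : V) : ‖J.TL x y z‖ ≤ ‖J.TL‖ * ‖x‖ * ‖y‖ * ‖z‖ :=
  ((J.TL x y).le_opNorm z).trans (by gcongr; exact J.norm_TL_le x y)

/-- Both sides solve the same linear equation `r' = -T(z, v) r - r T(v, w)` with the same initial
value; Grönwall's inequality applied to their difference gives equality. -/
theorem IsFlowLine.bergman_eq {v : V} {z w : ℝ → V} {h k : ℝ → V →L[ℂ] V}
    (hz : J.IsFlowLine v z) (hw : J.IsFlowLine v w) (hh : J.IsTransport v z h)
    (hk : J.IsTransport v w k) {t : ℝ} (ht : t ∈ Set.Icc (0 : ℝ) 1) :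
    J.BL (z t) (w t) = h t * J.BL (z 0) (w 0) * J.adj (k t) := by
  obtain ⟨R, hR⟩ : ∃ R, ∀ t ∈ Set.Icc (0 : ℝ) 1, ‖z t‖ ≤ R :=
    isCompact_Icc.exists_bound_of_continuousOn (hz.continuousOn J)
  obtain ⟨R', hR'⟩ : ∃ R, ∀ t ∈ Set.Icc (0 : ℝ) 1, ‖w t‖ ≤ R :=
    isCompact_Icc.exists_bound_of_continuousOn (hw.continuousOn J)
  have hadj : ∀ t ∈ Set.Icc (0 : ℝ) 1, HasDerivWithinAt (fun t => J.adjL (k t))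
      (-(J.adjL (k t) * J.TL v (w t))) (Set.Icc 0 1) t := by
    intro t ht
    have h1 := J.adjL.hasFDerivAt.comp_hasDerivWithinAt t (hk.2 t ht)
    rw [map_neg, adjL_apply _ (_ * _), adj_mul, adj_TL] at h1
    exact h1
  set r : ℝ → V →L[ℂ] V := fun t =>
    J.BL (z t) (w t) - h t * J.BL (z 0) (w 0) * J.adjL (k t) with hr
  have hderiv : ∀ t ∈ Set.Icc (0 : ℝ) 1, HasDerivWithinAt r
      (-(J.TL (z t) v * r t) - r t * J.TL v (w t)) (Set.Icc 0 1) t := by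
    intro t ht
    have h1 := (J.hasDerivWithinAt_BL (hz t ht) (hw t ht)).sub
      (((hh.2 t ht).mul_const (J.BL (z 0) (w 0))).mul (hadj t ht))
    refine h1.congr_deriv ?_
    simp only [hr]
    noncomm_ring
  have h0 := eq_zero_of_abs_deriv_le_mul_abs_self_of_eq_zero_right
    (K := ‖J.TL‖ * R * ‖v‖ + ‖J.TL‖ * ‖v‖ * R')
    (fun t ht => (hderiv t ht).continuousWithinAt)
    (fun t ht => (hderiv t (Set.Ico_subset_Icc_self ht)).Ici_of_Icc ht)
    (by simp [hr, hh.1, hk.1, adjL_apply, adj_one]) (fun t ht => by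
      have ht' := Set.Ico_subset_Icc_self ht
      calc ‖-(J.TL (z t) v * r t) - r t * J.TL v (w t)‖
          ≤ ‖J.TL (z t) v * r t‖ + ‖r t * J.TL v (w t)‖ := by
            rw [← norm_neg (J.TL (z t) v * r t)]
            exact norm_sub_le _ _
        _ ≤ ‖J.TL (z t) v‖ * ‖r t‖ + ‖r t‖ * ‖J.TL v (w t)‖ :=
            add_le_add (norm_mul_le _ _) (norm_mul_le _ _)
        _ ≤ (‖J.TL‖ * R * ‖v‖) * ‖r t‖ + ‖r t‖ * (‖J.TL‖ * ‖v‖ * R') := by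
            have h1 : ‖J.TL (z t) v‖ ≤ ‖J.TL‖ * R * ‖v‖ :=
              (J.norm_TL_le _ _).trans (by gcongr; exact hR t ht')
            have h2 : ‖J.TL v (w t)‖ ≤ ‖J.TL‖ * ‖v‖ * R' :=
              (J.norm_TL_le _ _).trans (by gcongr; exact hR' t ht')
            gcongr
        _ = (‖J.TL‖ * R * ‖v‖ + ‖J.TL‖ * ‖v‖ * R') * ‖r t‖ := by ring) t ht
  exact sub_eq_zero.1 h0

/-- In `field_sub` the linear term contributes the rate `‖TL‖ R ‖v‖`. The quadratic one contributes
as much again, because `‖z - w‖ ≤ 2 R`. -/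
theorem IsFlowLine.dist_le {v : V} {z w : ℝ → V} (hz : J.IsFlowLine v z) (hw : J.IsFlowLine v w)
    {R : ℝ} (hR : ∀ t ∈ Set.Icc (0 : ℝ) 1, ‖z t‖ ≤ R) (hR' : ∀ t ∈ Set.Icc (0 : ℝ) 1, ‖w t‖ ≤ R)
    {t : ℝ} (ht : t ∈ Set.Icc (0 : ℝ) 1) :
    ‖z t - w t‖ ≤ ‖z 0 - w 0‖ * Real.exp (2 * ‖J.TL‖ * R * ‖v‖) := by
  have hR0 : 0 ≤ R := (norm_nonneg _).trans (hR t ht)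
  have h := norm_le_gronwallBound_of_norm_deriv_right_le (f := fun t => z t - w t)
    (f' := fun t => J.field v (z t) - J.field v (w t)) (δ := ‖z 0 - w 0‖)
    (K := 2 * ‖J.TL‖ * R * ‖v‖) (ε := 0)
    ((hz.continuousOn J).sub (hw.continuousOn J))
    (fun t ht => ((hz t (Set.Ico_subset_Icc_self ht)).sub
      (hw t (Set.Ico_subset_Icc_self ht))).Ici_of_Icc ht) le_rfl (fun t ht => by
      have ht' := Set.Ico_subset_Icc_self ht
      have h1 := hR t ht'
      have h2 := hR' t ht'
      have h3 : ‖z t - w t‖ ≤ R + R := (norm_sub_le _ _).trans (add_le_add h1 h2)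
      rw [field_sub, add_zero]
      calc ‖-(J.TL (w t) v (z t - w t)) - (1 / 2 : ℝ) • J.TL (z t - w t) v (z t - w t)‖
          ≤ ‖J.TL (w t) v (z t - w t)‖ + ‖(1 / 2 : ℝ) • J.TL (z t - w t) v (z t - w t)‖ := by
            rw [← norm_neg (J.TL (w t) v (z t - w t))]
            exact norm_sub_le _ _
        _ ≤ ‖J.TL‖ * R * ‖v‖ * ‖z t - w t‖ +
            1 / 2 * (‖J.TL‖ * (R + R) * ‖v‖ * ‖z t - w t‖) := by
            rw [norm_smul, Real.norm_of_nonneg (by norm_num : (0 : ℝ) ≤ 1 / 2)]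
            refine add_le_add ((J.norm_TL_apply_le _ _ _).trans (by gcongr)) ?_
            gcongr
            exact (J.norm_TL_apply_le _ _ _).trans (by gcongr)
        _ = 2 * ‖J.TL‖ * R * ‖v‖ * ‖z t - w t‖ := by ring) t ht
  rw [gronwallBound_ε0, sub_zero] at h
  exact h.trans (mul_le_mul_of_nonneg_left
    (Real.exp_le_exp.2 (mul_le_of_le_one_right (by positivity) ht.2)) (norm_nonneg _))

theorem IsFlowLine.unique {v : V} {z w : ℝ → V} (hz : J.IsFlowLine v z) (hw : J.IsFlowLine v w)
    (h0 : z 0 = w 0) {t : ℝ} (ht : t ∈ Set.Icc (0 : ℝ) 1) : z t = w t := by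
  obtain ⟨R, hR⟩ : ∃ R, ∀ t ∈ Set.Icc (0 : ℝ) 1, ‖z t‖ ≤ R :=
    isCompact_Icc.exists_bound_of_continuousOn (hz.continuousOn J)
  obtain ⟨R', hR'⟩ : ∃ R, ∀ t ∈ Set.Icc (0 : ℝ) 1, ‖w t‖ ≤ R :=
    isCompact_Icc.exists_bound_of_continuousOn (hw.continuousOn J)
  have h := hz.dist_le J hw (R := max R R') (fun t ht => (hR t ht).trans (le_max_left _ _))
    (fun t ht => (hR' t ht).trans (le_max_right _ _)) ht
  rw [h0, sub_self, norm_zero, zero_mul] at h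
  exact sub_eq_zero.1 (norm_le_zero_iff.1 h)

theorem IsFlowLine.reverse {v : V} {z : ℝ → V} (hz : J.IsFlowLine v z) :
    J.IsFlowLine (-v) (fun t => z (1 - t)) := by
  intro t ht
  have ht' : 1 - t ∈ Set.Icc (0 : ℝ) 1 := ⟨by linarith [ht.2], by linarith [ht.1]⟩
  have h1 : HasDerivWithinAt (fun t : ℝ => 1 - t) (-1) (Set.Icc 0 1) t :=
    (hasDerivWithinAt_id t _).const_sub 1
  have h2 := (hz _ ht').scomp t h1 (fun s hs => ⟨by linarith [hs.2], by linarith [hs.1]⟩)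
  refine h2.congr_deriv ?_
  simp only [field, map_neg, _root_.neg_apply]
  module

/-- Picard–Lindelöf for the pair of flow line and transport, in a ball of radius 1/2. For small `v`
the field has norm at most 1/2 there, so solutions live for unit time, uniformly in the starting
point; `A` bounds the two components of the field. The bound on `h t - 1` keeps the transport
invertible. -/
theorem exists_isFlowLine (R : ℝ) : ∃ δ > 0, ∀ v : V, ‖v‖ ≤ δ → ∀ x : V, ‖x‖ ≤ R →
    ∃ z h, z 0 = x ∧ J.IsFlowLine v z ∧ J.IsTransport v z h ∧
      ∀ t ∈ Set.Icc (0 : ℝ) 1, ‖z t‖ ≤ R + 1 ∧ ‖h t - 1‖ ≤ 1 / 2 := by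
  have hA : 0 < 1 + ‖J.TL‖ * (|R| + 1) ^ 2 + ‖J.TL‖ * (|R| + 1) * 2 := by positivity
  set A := 1 + ‖J.TL‖ * (|R| + 1) ^ 2 + ‖J.TL‖ * (|R| + 1) * 2 with hAdef
  refine ⟨1 / (2 * A), by positivity, fun v hv x hx => ?_⟩
  set F : V × (V →L[ℂ] V) → V × (V →L[ℂ] V) :=
    fun p => (J.field v p.1, -(J.TL p.1 v * p.2)) with hF
  have hFc : ContDiff ℝ 1 F := by
    have hT : ContDiff ℝ 1 fun p : V × (V →L[ℂ] V) => J.TL p.1 v :=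
      (J.TL.contDiff.comp contDiff_fst).clm_apply contDiff_const
    have hT' : ContDiff ℝ 1 fun p : V × (V →L[ℂ] V) => J.TL p.1 v p.1 :=
      (((ContinuousLinearMap.restrictScalarsL ℂ V V ℝ ℝ).contDiff).comp hT).clm_apply contDiff_fst
    exact (contDiff_const.sub (hT'.const_smul (1 / 2 : ℝ))).prodMk (hT.mul contDiff_snd).neg
  obtain ⟨K, hK⟩ := (hFc.locallyLipschitz.locallyLipschitzOn (s := Metric.closedBall
    ((x, 1) : V × (V →L[ℂ] V)) ((1 / 2 : NNReal) : ℝ))).exists_lipschitzOnWith_of_compact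
      (isCompact_closedBall _ _)
  have hball : ∀ p ∈ Metric.closedBall ((x, 1) : V × (V →L[ℂ] V)) ((1 / 2 : NNReal) : ℝ),
      ‖p.1‖ ≤ R + 1 ∧ ‖p.2 - 1‖ ≤ 1 / 2 := by
    intro p hp
    rw [Metric.mem_closedBall, Prod.dist_eq, max_le_iff, dist_eq_norm, dist_eq_norm] at hp
    obtain ⟨h1, h2⟩ := hp
    have h1' : ‖p.1 - x‖ ≤ 1 / 2 := by simpa using h1
    have h2' : ‖p.2 - 1‖ ≤ 1 / 2 := by simpa using h2
    refine ⟨?_, h2'⟩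
    have := norm_le_norm_add_norm_sub' p.1 x
    linarith
  have hbound : ∀ p ∈ Metric.closedBall ((x, 1) : V × (V →L[ℂ] V)) ((1 / 2 : NNReal) : ℝ),
      ‖F p‖ ≤ ((1 / 2 : NNReal) : ℝ) := by
    intro p hp
    obtain ⟨h1, h2⟩ := hball p hp
    have h1' : ‖p.1‖ ≤ |R| + 1 := h1.trans (by gcongr; exact le_abs_self R)
    have h2' : ‖p.2‖ ≤ 2 := by
      have h3 := norm_le_norm_add_norm_sub' p.2 1
      have h4 : ‖(1 : V →L[ℂ] V)‖ ≤ 1 := ContinuousLinearMap.norm_id_le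
      linarith
    have hAv : A * ‖v‖ ≤ 1 / 2 := by
      rw [le_div_iff₀ (by positivity)] at hv
      linarith
    have e1 : ‖F p‖ ≤ A * ‖v‖ := by
      rw [Prod.norm_def, max_le_iff]
      constructor
      · calc ‖v - (1 / 2 : ℝ) • J.TL p.1 v p.1‖ ≤ ‖v‖ + ‖(1 / 2 : ℝ) • J.TL p.1 v p.1‖ :=
              norm_sub_le _ _
          _ ≤ ‖v‖ + 1 * (‖J.TL‖ * (|R| + 1) * ‖v‖ * (|R| + 1)) := by
              rw [norm_smul, Real.norm_of_nonneg (by norm_num : (0 : ℝ) ≤ 1 / 2)]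
              gcongr
              · norm_num
              · exact (J.norm_TL_apply_le _ _ _).trans (by gcongr)
          _ ≤ A * ‖v‖ := by
              rw [hAdef]
              have : 0 ≤ ‖J.TL‖ * (|R| + 1) * 2 * ‖v‖ := by positivity
              nlinarith
      · calc ‖-(J.TL p.1 v * p.2)‖ ≤ ‖J.TL p.1 v‖ * ‖p.2‖ := by
              rw [norm_neg]; exact norm_mul_le _ _
          _ ≤ (‖J.TL‖ * (|R| + 1) * ‖v‖) * 2 := by
              gcongr
              exact (J.norm_TL_le _ _).trans (by gcongr)
          _ ≤ A * ‖v‖ := by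
              rw [hAdef]
              have : 0 ≤ (1 + ‖J.TL‖ * (|R| + 1) ^ 2) * ‖v‖ := by positivity
              nlinarith
    have : ((1 / 2 : NNReal) : ℝ) = 1 / 2 := by simp
    rw [this]
    exact e1.trans hAv
  have hPL : IsPicardLindelof (fun _ => F) (⟨0, by simp⟩ : Set.Icc (0 : ℝ) 1)
      ((x, 1) : V × (V →L[ℂ] V)) (1 / 2) 0 (1 / 2) K :=
    IsPicardLindelof.of_time_independent hbound hK (by simp)
  obtain ⟨α, h0, hmem, hα⟩ := hPL.exists_mem_closedBall
  have h0' : α 0 = (x, 1) := h0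
  refine ⟨fun t => (α t).1, fun t => (α t).2, by simp [h0'], fun t ht => ?_,
    ⟨by simp [h0'], fun t ht => ?_⟩, fun t ht => hball _ (hmem t ht)⟩
  · exact (ContinuousLinearMap.fst ℝ V (V →L[ℂ] V)).hasFDerivAt.comp_hasDerivWithinAt t (hα t ht)
  · exact (ContinuousLinearMap.snd ℝ V (V →L[ℂ] V)).hasFDerivAt.comp_hasDerivWithinAt t (hα t ht)

end HPJTS

namespace HPJTS

variable {V : Type*} [NormedAddCommGroup V] [NormedSpace ℂ V] [FiniteDimensional ℂ V]
  (J : HPJTS V)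

/-! ### Automorphisms of the domain -/

theorem det_ne_zero_of_norm_sub_one_le {A : V →L[ℂ] V} (h : ‖A - 1‖ ≤ 1 / 2) :
    LinearMap.det (A : V →ₗ[ℂ] V) ≠ 0 := by
  have hinj : LinearMap.ker (A : V →ₗ[ℂ] V) = ⊥ := by
    rw [LinearMap.ker_eq_bot']
    intro x hx
    have hx' : A x = 0 := hx
    have h1 : ‖x‖ ≤ 1 / 2 * ‖x‖ := by
      calc ‖x‖ = ‖(A - 1) x‖ := by
            rw [_root_.sub_apply, hx', zero_sub, norm_neg]; rfl
        _ ≤ ‖A - 1‖ * ‖x‖ := (A - 1).le_opNorm x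
        _ ≤ 1 / 2 * ‖x‖ := by gcongr
    have := norm_nonneg x
    exact norm_eq_zero.1 (by linarith)
  have h2 := (LinearMap.isUnit_iff_ker_eq_bot _).2 hinj
  exact (h2.map LinearMap.det).ne_zero

theorem injective_of_det_ne_zero {A : V →L[ℂ] V} (h : LinearMap.det (A : V →ₗ[ℂ] V) ≠ 0) {x : V}
    (hx : A x = 0) : x = 0 := by
  have h1 := (LinearMap.isUnit_iff_isUnit_det _).2 (isUnit_iff_ne_zero.2 h)
  exact (LinearMap.ker_eq_bot'.1 ((LinearMap.isUnit_iff_ker_eq_bot _).1 h1)) x hx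

/-- Flow lines do not leave the domain. -/
theorem IsFlowLine.mem_domain {v : V} {z : ℝ → V} {h : ℝ → V →L[ℂ] V} (hz : J.IsFlowLine v z)
    (hh : J.IsTransport v z h) (hdet : ∀ t ∈ Set.Icc (0 : ℝ) 1, ‖h t - 1‖ ≤ 1 / 2)
    (h0 : z 0 ∈ J.domain) {t : ℝ} (ht : t ∈ Set.Icc (0 : ℝ) 1) : z t ∈ J.domain := by
  -- `(B(z_s, z_s) x | x) = (B(z_0, z_0) h* x | h* x)` with `h*` injective; the connected flow line
  -- thus stays in one component of the positivity set.
  have hpos : ∀ s ∈ Set.Icc (0 : ℝ) 1, J.IsPosDef (J.B (z s) (z s)) := by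
    intro s hs x hx
    have h1 := hz.bergman_eq J hz hh hh hs
    have h2 : J.adj (h s) x ≠ 0 := fun h3 => hx <| injective_of_det_ne_zero (by
      rw [det_adj]
      exact (map_ne_zero _).2 (det_ne_zero_of_norm_sub_one_le (hdet s hs))) h3
    have h3 := J.isPosDef_bergman_of_mem h0 _ h2
    have h4 : J.form (J.B (z s) (z s) x) x =
        J.form (J.B (z 0) (z 0) (J.adj (h s) x)) (J.adj (h s) x) := by
      rw [← form_adj, ← coe_BL, ← coe_BL, h1]
      rfl
    rwa [h4]
  have hsub : z '' Set.Icc 0 1 ⊆ {u | J.IsPosDef (J.B u u)} := by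
    rintro _ ⟨s, hs, rfl⟩
    exact hpos s hs
  have hconn : IsPreconnected (z '' Set.Icc (0 : ℝ) 1) :=
    isPreconnected_Icc.image z (hz.continuousOn J)
  have h1 := hconn.subset_connectedComponentIn ⟨0, by simp, rfl⟩ hsub
  rw [domain, connectedComponentIn_eq h0]
  exact h1 ⟨t, ht, rfl⟩

theorem isOpen_domain : IsOpen J.domain := J.domain_eq_specBall ▸ J.isOpen_specBall

theorem zero_mem_domain : (0 : V) ∈ J.domain := J.domain_eq_specBall ▸ J.zero_mem_specBall

/-- Holomorphic automorphisms of the domain that transform the determinant of the Bergman operator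
by their Jacobian determinant. -/
structure IsAut (φ : V → V) (φ' : V → V →L[ℂ] V) : Prop where
  bijOn : Set.BijOn φ J.domain J.domain
  hasFDerivAt : ∀ z ∈ J.domain, HasFDerivAt φ (φ' z) z
  det_ne_zero : ∀ z ∈ J.domain, LinearMap.det (φ' z : V →ₗ[ℂ] V) ≠ 0
  det_bergman : ∀ z ∈ J.domain, ∀ w ∈ J.domain, LinearMap.det (J.B (φ z) (φ w)) =
    LinearMap.det (φ' z : V →ₗ[ℂ] V) * LinearMap.det (J.B z w) *
      conj (LinearMap.det (φ' w : V →ₗ[ℂ] V))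

theorem isAut_id : J.IsAut id fun _ => 1 where
  bijOn := Set.bijOn_id _
  hasFDerivAt z _ := hasFDerivAt_id z
  det_ne_zero z _ := by
    change LinearMap.det (1 : V →ₗ[ℂ] V) ≠ 0
    simp
  det_bergman z _ w _ := by
    change _ = LinearMap.det (1 : V →ₗ[ℂ] V) * _ * conj (LinearMap.det (1 : V →ₗ[ℂ] V))
    simp

variable {J} in
theorem IsAut.comp {φ ψ : V → V} {φ' ψ' : V → V →L[ℂ] V} (hφ : J.IsAut φ φ') (hψ : J.IsAut ψ ψ') :
    J.IsAut (φ ∘ ψ) fun z => φ' (ψ z) * ψ' z := by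
  have hdet : ∀ z, LinearMap.det ((φ' (ψ z) * ψ' z : V →L[ℂ] V) : V →ₗ[ℂ] V) =
      LinearMap.det (φ' (ψ z) : V →ₗ[ℂ] V) * LinearMap.det (ψ' z : V →ₗ[ℂ] V) := fun z => by
    rw [← LinearMap.det_comp]; rfl
  refine ⟨hφ.bijOn.comp hψ.bijOn, fun z hz => ?_, fun z hz => ?_, fun z hz w hw => ?_⟩
  · exact (hφ.hasFDerivAt _ (hψ.bijOn.mapsTo hz)).comp z (hψ.hasFDerivAt z hz)
  · rw [hdet]
    exact mul_ne_zero (hφ.det_ne_zero _ (hψ.bijOn.mapsTo hz)) (hψ.det_ne_zero z hz)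
  · rw [hdet, hdet, Function.comp_apply, Function.comp_apply,
      hφ.det_bergman _ (hψ.bijOn.mapsTo hz) _ (hψ.bijOn.mapsTo hw), hψ.det_bergman z hz w hw,
      map_mul]
    ring

/-- The flow is differentiable in the initial value, with the transport as its derivative. -/
theorem IsFlowLine.norm_sub_sub_le {v : V} {z w : ℝ → V} {h : ℝ → V →L[ℂ] V}
    (hz : J.IsFlowLine v z) (hw : J.IsFlowLine v w) (hh : J.IsTransport v z h) {R : ℝ}
    (hR : ∀ t ∈ Set.Icc (0 : ℝ) 1, ‖z t‖ ≤ R) (hR' : ∀ t ∈ Set.Icc (0 : ℝ) 1, ‖w t‖ ≤ R) :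
    ‖w 1 - z 1 - h 1 (w 0 - z 0)‖ ≤
      (1 / 2 * ‖J.TL‖ * ‖v‖ * Real.exp (2 * ‖J.TL‖ * R * ‖v‖) ^ 2 *
        Real.exp (‖J.TL‖ * R * ‖v‖ + 1)) * ‖w 0 - z 0‖ ^ 2 := by
  have hR0 : 0 ≤ R := (norm_nonneg _).trans (hR 0 (by simp))
  set E := Real.exp (2 * ‖J.TL‖ * R * ‖v‖) with hE
  set k := w 0 - z 0 with hk
  have hderiv : ∀ t ∈ Set.Icc (0 : ℝ) 1, HasDerivWithinAt (fun t => w t - z t - h t k)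
      (-(J.TL (z t) v (w t - z t - h t k)) - (1 / 2 : ℝ) • J.TL (w t - z t) v (w t - z t))
      (Set.Icc 0 1) t := by
    intro t ht
    have h1 := ((hw t ht).sub (hz t ht)).sub
      ((hh.2 t ht).complexClm_apply (hasDerivWithinAt_const t _ k))
    refine h1.congr_deriv ?_
    rw [field_sub, map_zero, map_sub _ (w t - z t) (h t k), add_zero, _root_.neg_apply,
      clm_mul_apply]
    abel
  -- The rate is enlarged by 1 so that it is nonzero and dividing by it in Grönwall's bound only
  -- decreases the value.
  have hgr := norm_le_gronwallBound_of_norm_deriv_right_le (δ := 0)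
    (K := ‖J.TL‖ * R * ‖v‖ + 1) (ε := 1 / 2 * ‖J.TL‖ * ‖v‖ * E ^ 2 * ‖k‖ ^ 2)
    (fun t ht => (hderiv t ht).continuousWithinAt)
    (fun t ht => (hderiv t (Set.Ico_subset_Icc_self ht)).Ici_of_Icc ht)
    (by simp [hh.1, hk]) (fun t ht => by
      have ht' := Set.Ico_subset_Icc_self ht
      have hδ := hw.dist_le J hz hR' hR ht'
      rw [← hE, ← hk] at hδ
      have hδ2 : ‖w t - z t‖ ^ 2 ≤ (‖k‖ * E) ^ 2 := by gcongr
      set r := w t - z t - h t k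
      calc ‖-(J.TL (z t) v r) - (1 / 2 : ℝ) • J.TL (w t - z t) v (w t - z t)‖
          ≤ ‖J.TL (z t) v r‖ + ‖(1 / 2 : ℝ) • J.TL (w t - z t) v (w t - z t)‖ := by
            rw [← norm_neg (J.TL (z t) v r)]
            exact norm_sub_le _ _
        _ ≤ ‖J.TL‖ * R * ‖v‖ * ‖r‖ + 1 / 2 * (‖J.TL‖ * ‖w t - z t‖ * ‖v‖ * ‖w t - z t‖) := by
            rw [norm_smul, Real.norm_of_nonneg (by norm_num : (0 : ℝ) ≤ 1 / 2)]
            refine add_le_add ((J.norm_TL_apply_le _ _ _).trans ?_) ?_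
            · gcongr
              exact hR t ht'
            · gcongr
              exact J.norm_TL_apply_le _ _ _
        _ = ‖J.TL‖ * R * ‖v‖ * ‖r‖ + 1 / 2 * ‖J.TL‖ * ‖v‖ * ‖w t - z t‖ ^ 2 := by ring
        _ ≤ (‖J.TL‖ * R * ‖v‖ + 1) * ‖r‖ + 1 / 2 * ‖J.TL‖ * ‖v‖ * (‖k‖ * E) ^ 2 := by
            gcongr
            linarith
        _ = (‖J.TL‖ * R * ‖v‖ + 1) * ‖r‖ + 1 / 2 * ‖J.TL‖ * ‖v‖ * E ^ 2 * ‖k‖ ^ 2 := by ring)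
    1 (by simp)
  have hK : 1 ≤ ‖J.TL‖ * R * ‖v‖ + 1 := le_add_of_nonneg_left (by positivity)
  rw [gronwallBound_of_K_ne_0 (by linarith)] at hgr
  refine hgr.trans ?_
  simp only [zero_mul, zero_add, sub_zero, mul_one]
  have hexp : 0 ≤ Real.exp (‖J.TL‖ * R * ‖v‖ + 1) - 1 := by
    have := Real.add_one_le_exp (‖J.TL‖ * R * ‖v‖ + 1)
    linarith
  calc 1 / 2 * ‖J.TL‖ * ‖v‖ * E ^ 2 * ‖k‖ ^ 2 / (‖J.TL‖ * R * ‖v‖ + 1) *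
        (Real.exp (‖J.TL‖ * R * ‖v‖ + 1) - 1)
      ≤ 1 / 2 * ‖J.TL‖ * ‖v‖ * E ^ 2 * ‖k‖ ^ 2 * Real.exp (‖J.TL‖ * R * ‖v‖ + 1) := by
        refine mul_le_mul (div_le_self (by positivity) hK) (by linarith) hexp (by positivity)
    _ = _ := by ring

/-- The automorphism is the time-one map. M is bounded, so one `δ` serves all starting points; the
time-one map of `-v` is the inverse. -/
theorem exists_isAut : ∃ δ > 0, ∀ v : V, ‖v‖ ≤ δ → ∃ φ φ', J.IsAut φ φ' ∧
    ∀ z, J.IsFlowLine v z → z 0 ∈ J.domain → φ (z 0) = z 1 := by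
  obtain ⟨R, -, hR⟩ := J.exists_norm_le
  rw [← domain_eq_specBall] at hR
  obtain ⟨δ, hδ, hflow⟩ := J.exists_isFlowLine R
  refine ⟨δ, hδ, fun v hv => ?_⟩
  have hex : ∀ u : V, ‖u‖ ≤ δ → ∀ x : V, ∃ (z : ℝ → V) (h : ℝ → V →L[ℂ] V), x ∈ J.domain →
      z 0 = x ∧ J.IsFlowLine u z ∧ J.IsTransport u z h ∧
      ∀ t ∈ Set.Icc (0 : ℝ) 1, ‖z t‖ ≤ R + 1 ∧ ‖h t - 1‖ ≤ 1 / 2 := by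
    intro u hu x
    by_cases hx : x ∈ J.domain
    · obtain ⟨z, h, hz⟩ := hflow u hu x (hR x hx)
      exact ⟨z, h, fun _ => hz⟩
    · exact ⟨0, 0, fun h => absurd h hx⟩
  choose z h hz using hex v hv
  choose z' h' hz' using hex (-v) (by rwa [norm_neg])
  have hmem : ∀ x ∈ J.domain, ∀ t ∈ Set.Icc (0 : ℝ) 1, z x t ∈ J.domain := by
    intro x hx t ht
    obtain ⟨h0, h1, h2, h3⟩ := hz x hx
    exact h1.mem_domain J h2 (fun s hs => (h3 s hs).2) (by rwa [h0]) ht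
  have hmem' : ∀ x ∈ J.domain, ∀ t ∈ Set.Icc (0 : ℝ) 1, z' x t ∈ J.domain := by
    intro x hx t ht
    obtain ⟨h0, h1, h2, h3⟩ := hz' x hx
    exact h1.mem_domain J h2 (fun s hs => (h3 s hs).2) (by rwa [h0]) ht
  have h01 : (1 : ℝ) ∈ Set.Icc (0 : ℝ) 1 := by simp
  have hinv : ∀ x ∈ J.domain, z' (z x 1) 1 = x := by
    intro x hx
    obtain ⟨h0, h1, -⟩ := hz x hx
    obtain ⟨k0, k1, -⟩ := hz' (z x 1) (hmem x hx 1 h01)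
    have := k1.unique J (h1.reverse J) (by rw [k0, sub_zero]) h01
    rw [this, sub_self, h0]
  have hinv' : ∀ x ∈ J.domain, z (z' x 1) 1 = x := by
    intro x hx
    obtain ⟨h0, h1, -⟩ := hz' x hx
    obtain ⟨k0, k1, -⟩ := hz (z' x 1) (hmem' x hx 1 h01)
    have h2 := h1.reverse J
    rw [neg_neg] at h2
    have := k1.unique J h2 (by rw [k0, sub_zero]) h01
    rw [this, sub_self, h0]
  refine ⟨fun x => z x 1, fun x => h x 1, ⟨⟨fun x hx => hmem x hx 1 h01, ?_, ?_⟩, ?_, ?_, ?_⟩, ?_⟩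
  · intro x hx y hy hxy
    rw [← hinv x hx, ← hinv y hy]
    exact congrArg (fun u => z' u 1) hxy
  · exact fun x hx => ⟨z' x 1, hmem' x hx 1 h01, hinv' x hx⟩
  · intro x hx
    obtain ⟨h0, h1, h2, h3⟩ := hz x hx
    rw [hasFDerivAt_iff_isLittleO_nhds_zero]
    refine Asymptotics.IsBigO.trans_isLittleO (g := fun k : V => ‖k‖ ^ 2) ?_
      (Asymptotics.isLittleO_norm_pow_id one_lt_two)
    have hev : ∀ᶠ k in 𝓝 (0 : V), x + k ∈ J.domain := by
      have hc : Filter.Tendsto (fun k : V => x + k) (𝓝 0) (𝓝 x) := by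
        have : Continuous fun k : V => x + k := by fun_prop
        simpa using this.tendsto 0
      exact hc (J.isOpen_domain.mem_nhds hx)
    refine Asymptotics.IsBigO.of_bound (1 / 2 * ‖J.TL‖ * ‖v‖ *
      Real.exp (2 * ‖J.TL‖ * (R + 1) * ‖v‖) ^ 2 * Real.exp (‖J.TL‖ * (R + 1) * ‖v‖ + 1)) ?_
    filter_upwards [hev] with k hk
    obtain ⟨k0, k1, k2, k3⟩ := hz (x + k) hk
    have := h1.norm_sub_sub_le J k1 h2 (fun t ht => (h3 t ht).1) (fun t ht => (k3 t ht).1)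
    rw [h0, k0, add_sub_cancel_left] at this
    rwa [norm_pow, norm_norm]
  · intro x hx
    exact det_ne_zero_of_norm_sub_one_le ((hz x hx).2.2.2 1 h01).2
  · intro x hx y hy
    obtain ⟨h0, h1, h2, h3⟩ := hz x hx
    obtain ⟨k0, k1, k2, k3⟩ := hz y hy
    have := h1.bergman_eq J k1 h2 k2 h01
    rw [h0, k0] at this
    rw [← coe_BL, ← coe_BL, this, ← det_adj, ← LinearMap.det_comp, ← LinearMap.det_comp]
    rfl
  · intro w hw hw0
    obtain ⟨h0, h1, -⟩ := hz (w 0) hw0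
    exact h1.unique J hw h0 h01

theorem _root_.Real.hasDerivAt_tanh' (x : ℝ) :
    HasDerivAt Real.tanh (1 - Real.tanh x ^ 2) x := by
  have hc := (Real.cosh_pos x).ne'
  have h := (Real.hasDerivAt_sinh x).div (Real.hasDerivAt_cosh x) hc
  have heq : Real.sinh / Real.cosh = Real.tanh :=
    funext fun y => (Real.tanh_eq_sinh_div_cosh y).symm
  refine HasDerivAt.congr_deriv (heq ▸ h) ?_
  rw [Real.tanh_eq_sinh_div_cosh]
  field_simp

/-- The automorphisms act transitively on the domain. -/
theorem exists_isAut_apply_zero {w : V} (hw : w ∈ J.domain) :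
    ∃ φ φ', J.IsAut φ φ' ∧ φ 0 = w := by
  obtain ⟨δ, hδ, haut⟩ := J.exists_isAut
  obtain ⟨s, e, lam, he, -, hwc⟩ := J.exists_spectral w
  change w = IsFrame.comb e lam at hwc
  rw [hwc, domain_eq_specBall] at hw
  have hlam := he.comb_mem_specBall.1 hw
  set m : s → ℝ := fun i => Real.artanh (lam i) with hm
  have htanh : ∀ i, Real.tanh (m i) = lam i := fun i =>
    Real.tanh_artanh (abs_lt.1 ((sq_lt_one_iff_abs_lt_one _).1 (hlam i)))
  -- The equation `tanh' = 1 - tanh²`, scaled by `m_i`, is the flow equation of `v = ∑ m_i e_i` in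
  -- each coordinate.
  set γ : ℝ → V := fun x => IsFrame.comb e fun i => Real.tanh (x * m i) with hγ
  have hγmem : ∀ x, γ x ∈ J.domain := fun x => by
    rw [domain_eq_specBall]
    exact he.comb_mem_specBall.2 fun i => Real.tanh_sq_lt_one _
  set v := IsFrame.comb e m with hv
  have hγd : ∀ x, HasDerivAt γ (J.field v (γ x)) x := by
    intro x
    have h1 : HasDerivAt γ
        (∑ i, ((m i * (1 - Real.tanh (x * m i) ^ 2) : ℝ) : ℂ) • e i) x := by
      refine HasDerivAt.fun_sum fun i _ => ?_
      have h2 : HasDerivAt (fun x : ℝ => x * m i) (m i) x := by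
        simpa using (hasDerivAt_id x).mul_const (m i)
      have h3 := ((Real.hasDerivAt_tanh' (x * m i)).comp x h2).ofReal_comp.smul_const (e i)
      refine h3.congr_deriv ?_
      rw [mul_comm]
    refine h1.congr_deriv ?_
    have h4 : J.TL (γ x) v (γ x) = (2 : ℂ) • IsFrame.comb e
        fun i => Real.tanh (x * m i) * m i * Real.tanh (x * m i) := he.T_comb_comb _ _ _
    rw [field, h4, ← Complex.coe_smul, smul_smul, hv, IsFrame.comb, IsFrame.comb]
    simp only [Finset.smul_sum]
    rw [← Finset.sum_sub_distrib]
    refine Finset.sum_congr rfl fun i _ => ?_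
    push_cast
    module
  -- Only short `v` have a time-one automorphism, so `γ` on `[0, 1]` is cut into `N` pieces, each a
  -- flow line of `v / N`.
  obtain ⟨N, hN⟩ := exists_nat_gt (‖v‖ / δ)
  have hN0 : (0 : ℝ) < N := lt_of_le_of_lt (by positivity) hN
  have hvN : ‖(N : ℝ)⁻¹ • v‖ ≤ δ := by
    rw [norm_smul, norm_inv, Real.norm_of_nonneg hN0.le, inv_mul_le_iff₀ hN0]
    rw [div_lt_iff₀ hδ] at hN
    linarith
  obtain ⟨φ, φ', hφ, hline⟩ := haut _ hvN
  have hstep : ∀ k : ℕ, φ (γ (k / N)) = γ ((k + 1 : ℕ) / N) := by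
    intro k
    have h1 : J.IsFlowLine ((N : ℝ)⁻¹ • v) fun t => γ ((k + t) / N) := by
      intro t _
      have h2 : HasDerivAt (fun t : ℝ => (k + t) / N) (N : ℝ)⁻¹ t := by
        simpa using ((hasDerivAt_id t).const_add (k : ℝ)).div_const (N : ℝ)
      have h3 := ((hγd ((k + t) / N)).scomp t h2).hasDerivWithinAt (s := Set.Icc 0 1)
      refine h3.congr_deriv ?_
      simp only [field, map_smul, _root_.smul_apply]
      module
    have h2 := hline _ h1 (hγmem _)
    simpa using h2
  have hiter : ∀ k : ℕ, ∃ ψ ψ', J.IsAut ψ ψ' ∧ ψ 0 = γ (k / N) := by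
    intro k
    induction k with
    | zero => exact ⟨id, _, J.isAut_id, by simp [hγ, IsFrame.comb]⟩
    | succ k ih =>
      obtain ⟨ψ, ψ', h1, h2⟩ := ih
      exact ⟨φ ∘ ψ, _, hφ.comp h1, by rw [Function.comp_apply, h2, hstep]⟩
  obtain ⟨ψ, ψ', h1, h2⟩ := hiter N
  refine ⟨ψ, ψ', h1, h2.trans ?_⟩
  rw [div_self hN0.ne', hwc, hγ]
  simp [htanh]

theorem bergman_zero_right (z : V) : J.B z 0 = 1 := by
  ext u
  simp [B_apply]

/-- Transitivity moves `w` to 0, where `B(ζ, 0) = 1`; the Jacobian factors do not vanish. -/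
theorem det_bergman_ne_zero {z w : V} (hz : z ∈ J.domain) (hw : w ∈ J.domain) :
    LinearMap.det (J.B z w) ≠ 0 := by
  obtain ⟨φ, φ', hφ, rfl⟩ := J.exists_isAut_apply_zero hw
  obtain ⟨ζ, hζ, rfl⟩ := hφ.bijOn.surjOn hz
  rw [hφ.det_bergman ζ hζ 0 J.zero_mem_domain, bergman_zero_right, map_one, mul_one]
  exact mul_ne_zero (hφ.det_ne_zero ζ hζ)
    ((map_ne_zero _).2 (hφ.det_ne_zero 0 J.zero_mem_domain))

end HPJTS

/-- The determinant of a family of operators is holomorphic if all its orbits are. -/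
theorem LinearMap.differentiable_det {E F : Type*} [NormedAddCommGroup E] [NormedSpace ℂ E]
    [NormedAddCommGroup F] [NormedSpace ℂ F] [FiniteDimensional ℂ F] {A : E → F →ₗ[ℂ] F}
    (hA : ∀ u, Differentiable ℂ fun z => A z u) :
    Differentiable ℂ fun z => LinearMap.det (A z) := by
  let b := Module.finBasis ℂ F
  have h : (fun z => LinearMap.det (A z)) = fun z =>
      ∑ σ : Equiv.Perm (Fin (Module.finrank ℂ F)), ((Equiv.Perm.sign σ : ℤ) : ℂ) *
        ∏ i, LinearMap.toContinuousLinearMap (b.coord (σ i)) (A z (b i)) := by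
    funext z
    rw [← LinearMap.det_toMatrix b, Matrix.det_apply']
    simp [LinearMap.toMatrix_apply]
  rw [h]
  refine Differentiable.fun_sum fun σ _ => Differentiable.const_mul ?_ _
  intro z
  exact (HasFDerivAt.finsetProd fun i _ =>
    ((LinearMap.toContinuousLinearMap (b.coord (σ i))).differentiable.comp
      (hA (b i)) z).hasFDerivAt).differentiableAt

/-! ### Holomorphy and symmetry of `det B`, change of variables and the mean value property -/

namespace HPJTS

variable {V : Type*} [NormedAddCommGroup V] [NormedSpace ℂ V] [FiniteDimensional ℂ V] (J : HPJTS V)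

theorem differentiable_triple_self (c : V) : Differentiable ℂ fun z => J.triple z c z := by
  let L : V →ₗ[ℂ] V →ₗ[ℂ] V :=
    { toFun := fun z => J.triple z c
      map_add' := fun x y => by simp
      map_smul' := fun a x => by simp }
  let L' : V →L[ℂ] V →L[ℂ] V := LinearMap.toContinuousLinearMap
    ((LinearMap.toContinuousLinearMap : (V →ₗ[ℂ] V) ≃ₗ[ℂ] (V →L[ℂ] V)).toLinearMap ∘ₗ L)
  exact L'.differentiable.clm_apply differentiable_id

theorem differentiable_bergman (w u : V) : Differentiable ℂ fun z => J.B z w u := by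
  simp only [B_apply]
  have h1 : Differentiable ℂ fun z => J.triple z w u := by
    simp_rw [fun z => J.triple_symm z w u]
    exact (LinearMap.toContinuousLinearMap (J.triple u w)).differentiable
  exact (h1.const_sub u).add ((J.differentiable_triple_self _).const_smul _)

theorem differentiable_det_bergman (w : V) :
    Differentiable ℂ fun z => LinearMap.det (J.B z w) :=
  LinearMap.differentiable_det (J.differentiable_bergman w)

theorem conj_det_bergman (z w : V) :
    conj (LinearMap.det (J.B z w)) = LinearMap.det (J.B w z) := by
  have h : J.adj (J.BL z w) = J.BL w z := J.adj_eq fun x y => by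
    simpa only [← coe_BL, ContinuousLinearMap.coe_coe] using J.form_bergman z w x y
  rw [← coe_BL, ← coe_BL, ← h, det_adj]

variable {J}

/-- The absolute value of the real determinant of a complex linear operator. -/
theorem abs_det_restrictScalars (A : V →L[ℂ] V) :
    |(A.restrictScalars ℝ).det| = ‖LinearMap.det (A : V →ₗ[ℂ] V)‖ ^ 2 := by
  have h : (A.restrictScalars ℝ).det = Algebra.norm ℝ (LinearMap.det (A : V →ₗ[ℂ] V)) :=
    LinearMap.det_restrictScalars (R := ℝ) (S := ℂ) (f := (A : V →ₗ[ℂ] V))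
  rw [h, Algebra.norm_complex_eq]
  simp [Complex.normSq_eq_norm_sq]

section Integral

variable [MeasurableSpace V] [BorelSpace V] (μ : Measure V) [μ.IsAddHaarMeasure]
  {F : Type*} [NormedAddCommGroup F] [NormedSpace ℝ F] {s : Set V} {φ : V → V} {φ' : V → V →L[ℂ] V}

theorem setIntegral_comp_of_bijOn (hs : MeasurableSet s) (hφ : Set.BijOn φ s s)
    (hφ' : ∀ z ∈ s, HasFDerivAt φ (φ' z) z) (g : V → F) :
    ∫ z in s, g z ∂μ = ∫ z in s, ‖LinearMap.det (φ' z : V →ₗ[ℂ] V)‖ ^ 2 • g (φ z) ∂μ := by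
  have h := integral_image_eq_integral_abs_det_fderiv_smul μ hs
    (fun z hz => ((hφ' z hz).restrictScalars ℝ).hasFDerivWithinAt) hφ.injOn g
  simpa only [hφ.image_eq, abs_det_restrictScalars] using h

theorem integrableOn_comp_iff_of_bijOn (hs : MeasurableSet s) (hφ : Set.BijOn φ s s)
    (hφ' : ∀ z ∈ s, HasFDerivAt φ (φ' z) z) (g : V → F) :
    IntegrableOn g s μ ↔
      IntegrableOn (fun z => ‖LinearMap.det (φ' z : V →ₗ[ℂ] V)‖ ^ 2 • g (φ z)) s μ := by
  have h := integrableOn_image_iff_integrableOn_abs_det_fderiv_smul μ hs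
    (fun z hz => ((hφ' z hz).restrictScalars ℝ).hasFDerivWithinAt) hφ.injOn g
  simpa only [hφ.image_eq, abs_det_restrictScalars] using h

end Integral

theorem norm_det_smul_one {c : ℂ} (hc : ‖c‖ = 1) :
    ‖LinearMap.det ((c • (1 : V →L[ℂ] V) : V →L[ℂ] V) : V →ₗ[ℂ] V)‖ = 1 := by
  have : ((c • (1 : V →L[ℂ] V) : V →L[ℂ] V) : V →ₗ[ℂ] V) = c • LinearMap.id := rfl
  rw [this, LinearMap.det_smul]
  simp [hc]

variable (J)

theorem smul_mem_domain {c : ℂ} (hc : ‖c‖ ≤ 1) {u : V} (hu : u ∈ J.domain) : c • u ∈ J.domain := by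
  rw [domain_eq_specBall] at *
  exact J.smul_mem_specBall hc hu

theorem neg_mem_domain {u : V} (hu : u ∈ J.domain) : -u ∈ J.domain := by
  simpa using J.smul_mem_domain (c := -1) (by simp) hu

theorem bijOn_smul_domain {c : ℂ} (hc : ‖c‖ = 1) :
    Set.BijOn (fun z : V => c • z) J.domain J.domain := by
  have hc0 : c ≠ 0 := fun h => by simp [h] at hc
  refine ⟨fun z hz => J.smul_mem_domain hc.le hz, (smul_right_injective V hc0).injOn,
    fun z hz => ⟨c⁻¹ • z, J.smul_mem_domain (by simp [hc]) hz, smul_inv_smul₀ hc0 z⟩⟩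

/-- M is balanced, so `c ↦ f (c z)` is holomorphic up to the closed unit disc and the one-variable
mean value property applies. -/
theorem circleAverage_smul {f : V → ℂ} (hf : DifferentiableOn ℂ f J.domain) {z : V}
    (hz : z ∈ J.domain) : ∫ θ in (0)..(2 * Real.pi), f (circleMap 0 1 θ • z) =
      (2 * Real.pi) • f 0 := by
  have h1 : DifferentiableOn ℂ (fun c : ℂ => f (c • z)) (Metric.closedBall 0 |1|) :=
    hf.comp (by fun_prop) fun c hc => J.smul_mem_domain (by simpa using hc) hz
  have h2 := (h1.diffContOnCl_ball subset_rfl).circleAverage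
  rw [Real.circleAverage_def, zero_smul] at h2
  rw [← h2, smul_inv_smul₀ Real.two_pi_pos.ne']

section Integral

variable [MeasurableSpace V] (μ : Measure V) [μ.IsAddHaarMeasure]

theorem measure_domain_lt_top : μ J.domain < ⊤ := by
  obtain ⟨R, -, hR⟩ := J.exists_norm_le
  have := FiniteDimensional.proper ℂ V
  refine (Metric.isBounded_iff_subset_closedBall 0).2 ⟨R, fun u hu => ?_⟩ |>.measure_lt_top
  rw [domain_eq_specBall] at hu
  simpa using hR u hu

theorem measure_domain_ne_zero : μ J.domain ≠ 0 :=
  (J.isOpen_domain.measure_pos μ ⟨0, J.zero_mem_domain⟩).ne'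

variable [BorelSpace V]

theorem setIntegral_smul_domain {c : ℂ} (hc : ‖c‖ = 1) {F : Type*} [NormedAddCommGroup F]
    [NormedSpace ℝ F] (g : V → F) :
    ∫ z in J.domain, g (c • z) ∂μ = ∫ z in J.domain, g z ∂μ := by
  rw [setIntegral_comp_of_bijOn μ J.isOpen_domain.measurableSet (J.bijOn_smul_domain hc)
    (φ' := fun _ => c • 1) (fun z _ => (c • (1 : V →L[ℂ] V)).hasFDerivAt) g]
  simp only [norm_det_smul_one hc, one_pow, one_smul]

theorem integrableOn_smul_domain {c : ℂ} (hc : ‖c‖ = 1) {F : Type*} [NormedAddCommGroup F]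
    [NormedSpace ℝ F] {g : V → F} (hg : IntegrableOn g J.domain μ) :
    IntegrableOn (fun z => g (c • z)) J.domain μ := by
  rw [integrableOn_comp_iff_of_bijOn μ J.isOpen_domain.measurableSet (J.bijOn_smul_domain hc)
    (φ' := fun _ => c • 1) (fun z _ => (c • (1 : V →L[ℂ] V)).hasFDerivAt) g] at hg
  simpa only [norm_det_smul_one hc, one_pow, one_smul] using hg

/-- The mean value property of holomorphic functions on the domain. -/
theorem setIntegral_domain {f : V → ℂ} (hf : DifferentiableOn ℂ f J.domain)
    (hi : IntegrableOn f J.domain μ) :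
    ∫ z in J.domain, f z ∂μ = μ.real J.domain • f 0 := by
  have := FiniteDimensional.proper ℂ V
  have hπ : (0 : ℝ) < 2 * Real.pi := Real.two_pi_pos
  have hm := J.isOpen_domain.measurableSet
  have hfin : Fact (μ J.domain < ⊤) := ⟨J.measure_domain_lt_top μ⟩
  have hnorm : ∀ θ, ‖circleMap 0 1 θ‖ = 1 := fun θ => by simp
  have hcont : ContinuousOn (Function.uncurry fun (θ : ℝ) z => f (circleMap 0 1 θ • z))
      (Set.uIoc 0 (2 * Real.pi) ×ˢ J.domain) := by
    refine hf.continuousOn.comp (Continuous.continuousOn ?_) fun p hp =>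
      J.smul_mem_domain (hnorm _).le hp.2
    exact ((continuous_circleMap 0 1).comp continuous_fst).smul continuous_snd
  have hint : Integrable (Function.uncurry fun (θ : ℝ) z => f (circleMap 0 1 θ • z))
      ((volume.restrict (Set.uIoc 0 (2 * Real.pi))).prod (μ.restrict J.domain)) := by
    rw [integrable_prod_iff]
    · refine ⟨Filter.Eventually.of_forall fun θ => J.integrableOn_smul_domain μ (hnorm θ) hi, ?_⟩
      simp only [Function.uncurry_apply_pair]
      have : ∀ θ, ∫ z in J.domain, ‖f (circleMap 0 1 θ • z)‖ ∂μ = ∫ z in J.domain, ‖f z‖ ∂μ :=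
        fun θ => J.setIntegral_smul_domain μ (hnorm θ) fun z => ‖f z‖
      simp only [this]
      rw [Set.uIoc_of_le hπ.le]
      exact integrable_const _
    · rw [Measure.prod_restrict]
      exact hcont.aestronglyMeasurable (measurableSet_uIoc.prod hm)
  -- The double integral is computed in both orders: rotations preserve the measure, and for fixed
  -- `z` the circle average is `f 0`.
  have h1 : ∫ θ in (0)..(2 * Real.pi), ∫ z in J.domain, f (circleMap 0 1 θ • z) ∂μ =
      (2 * Real.pi) • ∫ z in J.domain, f z ∂μ := by
    simp_rw [fun θ => J.setIntegral_smul_domain μ (hnorm θ) f]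
    simp
  have h2 : ∫ θ in (0)..(2 * Real.pi), ∫ z in J.domain, f (circleMap 0 1 θ • z) ∂μ =
      ∫ z in J.domain, (∫ θ in (0)..(2 * Real.pi), f (circleMap 0 1 θ • z)) ∂μ :=
    intervalIntegral_integral_swap hint
  have h3 : ∫ z in J.domain, (∫ θ in (0)..(2 * Real.pi), f (circleMap 0 1 θ • z)) ∂μ =
      ∫ z in J.domain, (2 * Real.pi) • f 0 ∂μ :=
    setIntegral_congr_fun hm fun z hz => J.circleAverage_smul hf hz
  rw [h1, h3, setIntegral_const, smul_comm] at h2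
  exact smul_right_injective ℂ hπ.ne' h2

end Integral

end HPJTS

/-- An entire function on a normed space is determined by its germ at the origin. -/
theorem Differentiable.eq_of_eventuallyEq_zero {E : Type*} [NormedAddCommGroup E]
    [NormedSpace ℂ E] {f g : E → ℂ} (hf : Differentiable ℂ f) (hg : Differentiable ℂ g)
    (h : f =ᶠ[𝓝 0] g) : f = g := by
  funext z
  have hc : Differentiable ℂ fun c : ℂ => c • z := by fun_prop
  have h0 : Filter.Tendsto (fun c : ℂ => c • z) (𝓝 0) (𝓝 0) := by
    simpa using hc.continuous.tendsto 0
  have h1 := AnalyticOnNhd.eq_of_eventuallyEq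
    ((hf.comp hc).differentiableOn.analyticOnNhd isOpen_univ)
    ((hg.comp hc).differentiableOn.analyticOnNhd isOpen_univ) (h0.eventually h)
  simpa using congrFun h1 1

/-! ### The reproducing kernel and the dual kernel: existence and uniqueness -/

namespace HPJTS

variable {V : Type*} [NormedAddCommGroup V] [NormedSpace ℂ V] [FiniteDimensional ℂ V] (J : HPJTS V)

section Cond

variable [MeasurableSpace V] (μ : Measure V)

theorem integral_cond_domain (f : V → ℂ) :
    ∫ z, f z ∂(ProbabilityTheory.cond μ J.domain) =
      (μ.real J.domain)⁻¹ • ∫ z in J.domain, f z ∂μ := by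
  rw [ProbabilityTheory.cond, integral_smul_measure, ENNReal.toReal_inv, Measure.real]

variable [μ.IsAddHaarMeasure]

theorem measureReal_domain_pos : 0 < μ.real J.domain :=
  ENNReal.toReal_pos (J.measure_domain_ne_zero μ) (J.measure_domain_lt_top μ).ne

theorem memLp_cond_domain_iff [BorelSpace V] {f : V → ℂ} (hf : ContinuousOn f J.domain) :
    MemLp f 2 (ProbabilityTheory.cond μ J.domain) ↔
      IntegrableOn (fun z => ‖f z‖ ^ 2) J.domain μ := by
  have := FiniteDimensional.proper ℂ V
  have hm : AEStronglyMeasurable f (ProbabilityTheory.cond μ J.domain) :=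
    (hf.aestronglyMeasurable J.isOpen_domain.measurableSet).smul_measure _
  rw [memLp_two_iff_integrable_sq_norm hm, ProbabilityTheory.cond, integrable_smul_measure
    (ENNReal.inv_ne_zero.2 (J.measure_domain_lt_top μ).ne)
    (ENNReal.inv_ne_top.2 (J.measure_domain_ne_zero μ)), IntegrableOn]

theorem integrableOn_of_integrableOn_sq [BorelSpace V] {f : V → ℂ} (hf : ContinuousOn f J.domain)
    (h : IntegrableOn (fun z => ‖f z‖ ^ 2) J.domain μ) : IntegrableOn f J.domain μ := by
  have := FiniteDimensional.proper ℂ V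
  have : Fact (μ J.domain < ⊤) := ⟨J.measure_domain_lt_top μ⟩
  exact ((memLp_two_iff_integrable_sq_norm
    (hf.aestronglyMeasurable J.isOpen_domain.measurableSet)).2 h).integrable one_le_two

end Cond

variable {J} in
theorem IsAut.differentiableOn {φ : V → V} {φ' : V → V →L[ℂ] V} (h : J.IsAut φ φ') :
    DifferentiableOn ℂ φ J.domain :=
  fun z hz => (h.hasFDerivAt z hz).differentiableAt.differentiableWithinAt

variable {J} in
theorem IsAut.det_bergman_zero {φ : V → V} {φ' : V → V →L[ℂ] V} (h : J.IsAut φ φ') {z : V}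
    (hz : z ∈ J.domain) : LinearMap.det (J.B (φ z) (φ 0)) =
      LinearMap.det (φ' z : V →ₗ[ℂ] V) * conj (LinearMap.det (φ' 0 : V →ₗ[ℂ] V)) := by
  rw [h.det_bergman z hz 0 J.zero_mem_domain, bergman_zero_right, map_one, mul_one]

variable {J} in
-- The transformation rule at `w = 0` makes the Jacobian a constant multiple of the holomorphic
-- function `det B(φ z, φ 0)`, so no second derivative of `φ` is needed.
theorem IsAut.differentiableOn_det {φ : V → V} {φ' : V → V →L[ℂ] V} (h : J.IsAut φ φ') :
    DifferentiableOn ℂ (fun z => LinearMap.det (φ' z : V →ₗ[ℂ] V)) J.domain := by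
  have h0 : conj (LinearMap.det (φ' 0 : V →ₗ[ℂ] V)) ≠ 0 :=
    (map_ne_zero _).2 (h.det_ne_zero 0 J.zero_mem_domain)
  refine (((J.differentiable_det_bergman (φ 0)).comp_differentiableOn h.differentiableOn).mul_const
    (conj (LinearMap.det (φ' 0 : V →ₗ[ℂ] V)))⁻¹).congr fun z hz => ?_
  rw [Function.comp_apply, h.det_bergman_zero hz, mul_inv_cancel_right₀ h0]

/-- The Bergman kernel `1 / det B(z, w)` of the domain. -/
noncomputable def kernel (z w : V) : ℂ := (LinearMap.det (J.B z w))⁻¹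

theorem differentiableOn_kernel {w : V} (hw : w ∈ J.domain) :
    DifferentiableOn ℂ (fun z => J.kernel z w) J.domain :=
  (J.differentiable_det_bergman w).differentiableOn.inv fun _ hz => J.det_bergman_ne_zero hz hw

section Kernel

variable [MeasurableSpace V] [BorelSpace V] (μ : Measure V) [μ.IsAddHaarMeasure]

/-- Pulled back by an automorphism with `φ 0 = w`, the squared kernel times the real Jacobian is
constant, and M has finite measure. -/
theorem integrableOn_kernel_sq {w : V} (hw : w ∈ J.domain) :
    IntegrableOn (fun z => ‖J.kernel z w‖ ^ 2) J.domain μ := by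
  obtain ⟨φ, φ', hφ, rfl⟩ := J.exists_isAut_apply_zero hw
  have hm := J.isOpen_domain.measurableSet
  rw [integrableOn_comp_iff_of_bijOn μ hm hφ.bijOn hφ.hasFDerivAt]
  refine (integrableOn_const (C := ((‖LinearMap.det (φ' 0 : V →ₗ[ℂ] V)‖ ^ 2)⁻¹ : ℝ))
    (J.measure_domain_lt_top μ).ne).congr_fun (fun z hz => ?_) hm
  have hz0 : ‖LinearMap.det (φ' z : V →ₗ[ℂ] V)‖ ≠ 0 := norm_ne_zero_iff.2 (hφ.det_ne_zero z hz)
  have h0 : ‖LinearMap.det (φ' 0 : V →ₗ[ℂ] V)‖ ≠ 0 :=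
    norm_ne_zero_iff.2 (hφ.det_ne_zero 0 J.zero_mem_domain)
  simp only [kernel, hφ.det_bergman_zero hz, norm_inv, norm_mul, RCLike.norm_conj, smul_eq_mul]
  field_simp

/-- After the substitution by `φ` with `φ 0 = w`, one Jacobian factor cancels against the kernel.
The holomorphic integrand `f (φ z) det φ'(z) / det φ'(0)` remains, whose mean value is `f w`. -/
theorem integral_mul_conj_kernel {f : V → ℂ} (hf : DifferentiableOn ℂ f J.domain)
    (hi : IntegrableOn (fun z => ‖f z‖ ^ 2) J.domain μ) {w : V} (hw : w ∈ J.domain) :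
    ∫ z in J.domain, f z * conj (J.kernel z w) ∂μ = μ.real J.domain • f w := by
  obtain ⟨φ, φ', hφ, rfl⟩ := J.exists_isAut_apply_zero hw
  have hm := J.isOpen_domain.measurableSet
  have h0 := hφ.det_ne_zero 0 J.zero_mem_domain
  have hg : DifferentiableOn ℂ (fun z => f (φ z) * LinearMap.det (φ' z : V →ₗ[ℂ] V)) J.domain :=
    (hf.comp hφ.differentiableOn hφ.bijOn.mapsTo).mul hφ.differentiableOn_det
  rw [integrableOn_comp_iff_of_bijOn μ hm hφ.bijOn hφ.hasFDerivAt] at hi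
  have hgi := J.integrableOn_of_integrableOn_sq μ hg.continuousOn
    (hi.congr_fun (fun z _ => by simp only [norm_mul, smul_eq_mul]; ring) hm)
  rw [setIntegral_comp_of_bijOn μ hm hφ.bijOn hφ.hasFDerivAt]
  have h1 : ∀ z ∈ J.domain, ‖LinearMap.det (φ' z : V →ₗ[ℂ] V)‖ ^ 2 •
      (f (φ z) * conj (J.kernel (φ z) (φ 0))) = f (φ z) * LinearMap.det (φ' z : V →ₗ[ℂ] V) *
        (LinearMap.det (φ' 0 : V →ₗ[ℂ] V))⁻¹ := by
    intro z hz
    have hz0 := hφ.det_ne_zero z hz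
    have hz1 : conj (LinearMap.det (φ' z : V →ₗ[ℂ] V)) ≠ 0 := (map_ne_zero _).2 hz0
    rw [kernel, hφ.det_bergman_zero hz, Complex.real_smul, Complex.ofReal_pow, ← Complex.mul_conj',
      map_inv₀, map_mul, Complex.conj_conj]
    field_simp
  rw [setIntegral_congr_fun hm h1, integral_mul_const, J.setIntegral_domain μ hg hgi,
    smul_mul_assoc, mul_inv_cancel_right₀ h0]

theorem isReproducingKernel_kernel : J.IsReproducingKernel μ J.kernel where
  holo _ hw := J.differentiableOn_kernel hw
  memLp _ hw := (J.memLp_cond_domain_iff μ (J.differentiableOn_kernel hw).continuousOn).2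
    (J.integrableOn_kernel_sq μ hw)
  reproducing f hf hi w hw := by
    rw [J.memLp_cond_domain_iff μ hf.continuousOn] at hi
    rw [integral_cond_domain, J.integral_mul_conj_kernel μ hf hi hw,
      inv_smul_smul₀ (J.measureReal_domain_pos μ).ne']

variable {J μ}

/-- The reproducing kernel of the domain is unique. -/
theorem IsReproducingKernel.eq {K K' : V → V → ℂ} (hK : J.IsReproducingKernel μ K)
    (hK' : J.IsReproducingKernel μ K') {z w : V} (hz : z ∈ J.domain) (hw : w ∈ J.domain) :
    K z w = K' z w := by
  have hg : DifferentiableOn ℂ (fun z => K z w - K' z w) J.domain :=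
    (hK.holo w hw).sub (hK'.holo w hw)
  have hgL : MemLp (fun z => K z w - K' z w) 2 (ProbabilityTheory.cond μ J.domain) :=
    (hK.memLp w hw).sub (hK'.memLp w hw)
  have hi : Integrable (fun z => (K z w - K' z w) * conj (K z w))
      (ProbabilityTheory.cond μ J.domain) := hgL.integrable_mul (hK.memLp w hw).star
  have hi' : Integrable (fun z => (K z w - K' z w) * conj (K' z w))
      (ProbabilityTheory.cond μ J.domain) := hgL.integrable_mul (hK'.memLp w hw).star
  have h1 := hK.reproducing _ hg hgL w hw
  rw [hK'.reproducing _ hg hgL w hw, eq_comm, ← sub_eq_zero, ← integral_sub hi hi',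
    integral_cond_domain, smul_eq_zero_iff_right (inv_ne_zero (J.measureReal_domain_pos μ).ne')]
    at h1
  -- For `g = K(·, w) - K'(·, w)` both kernels reproduce `g w`, so the squared norm of `g` is `g w -
  -- g w = 0`.
  have h2 : ∀ z, (K z w - K' z w) * conj (K z w) - (K z w - K' z w) * conj (K' z w) =
      ((‖K z w - K' z w‖ ^ 2 : ℝ) : ℂ) := fun z => by
    rw [Complex.ofReal_pow, ← Complex.mul_conj', map_sub]
    ring
  simp_rw [h2] at h1
  rw [integral_complex_ofReal, Complex.ofReal_eq_zero, integral_eq_zero_iff_of_nonneg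
    (fun z => by positivity) ((J.memLp_cond_domain_iff μ hg.continuousOn).1 hgL)] at h1
  have h3 := Measure.eqOn_open_of_ae_eq h1 J.isOpen_domain (hg.continuousOn.norm.pow 2)
    continuousOn_const hz
  simpa [sub_eq_zero] using h3

end Kernel

variable {J}

theorem isDualKernel_det_bergman {K : V → V → ℂ}
    (hK : ∀ z ∈ J.domain, ∀ w ∈ J.domain, K z w = J.kernel z w) :
    J.IsDualKernel K fun z w => LinearMap.det (J.B z (-w)) where
  holo w := J.differentiable_det_bergman (-w)
  antiholo z := by
    simp_rw [conj_det_bergman]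
    exact (J.differentiable_det_bergman z).comp differentiable_id.neg
  ne_zero z hz w hw := by
    rw [hK z hz _ (J.neg_mem_domain hw)]
    exact inv_ne_zero (J.det_bergman_ne_zero hz (J.neg_mem_domain hw))
  eq_inv z hz w hw := by rw [hK z hz _ (J.neg_mem_domain hw), kernel, one_div, inv_inv]

/-- `Ψ z` need not lie in M, so agreement on M × M must be extended: first in `z`, then in `conj w`,
by the identity theorem for entire functions. -/
theorem IsDualKernel.eq {K L L' : V → V → ℂ} (hL : J.IsDualKernel K L)
    (hL' : J.IsDualKernel K L') : L = L' := by
  have hnhds : J.domain ∈ 𝓝 (0 : V) := J.isOpen_domain.mem_nhds J.zero_mem_domain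
  have h1 : ∀ z, ∀ w ∈ J.domain, L z w = L' z w := fun z w hw =>
    congrFun ((hL.holo w).eq_of_eventuallyEq_zero (hL'.holo w)
      (Filter.mem_of_superset hnhds fun z hz =>
        (hL.eq_inv z hz w hw).trans (hL'.eq_inv z hz w hw).symm)) z
  funext z w
  have h2 := congrFun ((hL.antiholo z).eq_of_eventuallyEq_zero (hL'.antiholo z)
    (Filter.mem_of_superset hnhds fun w hw => congrArg conj (h1 z w hw))) w
  exact (starRingEnd ℂ).injective h2

end HPJTS

end

theorem theorem4 {V : Type*} [NormedAddCommGroup V] [NormedSpace ℂ V] [FiniteDimensional ℂ V]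
    [MeasurableSpace V] [BorelSpace V] (μ : MeasureTheory.Measure V) [μ.IsAddHaarMeasure]
    (J : HPJTS V) :
    (∃ K : V → V → ℂ, J.IsReproducingKernel μ K) ∧
      ∀ K : V → V → ℂ, J.IsReproducingKernel μ K →
        (∃ L : V → V → ℂ, J.IsDualKernel K L) ∧
          ∀ L : V → V → ℂ, J.IsDualKernel K L →
            ∀ z ∈ J.domain, L (J.symplecticDuality z) (J.symplecticDuality z) = K z z := by
  refine ⟨⟨_, J.isReproducingKernel_kernel μ⟩, fun K hK => ?_⟩
  have hK' : ∀ z ∈ J.domain, ∀ w ∈ J.domain, K z w = J.kernel z w := fun z hz w hw =>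
    hK.eq (J.isReproducingKernel_kernel μ) hz hw
  have hL' := HPJTS.isDualKernel_det_bergman hK'
  refine ⟨⟨_, hL'⟩, fun L hL z hz => ?_⟩
  -- The goal is now `det B(Ψ z, -Ψ z) = (det B(z, z))⁻¹`, the determinant of
  -- `bergman_symplecticDuality`.
  rw [hL.eq hL', hK' z hz z hz, HPJTS.kernel]
  exact eq_inv_of_mul_eq_one_left
    (by rw [← map_mul, J.bergman_symplecticDuality hz, map_one])
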